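/- **Lemma 4.3.** Let $X$ be a nonempty, complete, geodesically complete CAT(0) space (geodesically complete: every nondegenerate geodesic segment extends to a geodesic line) which is $P_0$-packed at scale $r_0$ for some $P_0,r_0>0$, i.e. every subset of a closed ball of radius $3r_0$ whose distinct points are at distance $>r_0$ from each other has at most $P_0$ elements. Let $\Gamma$ be a group of isometries of $X$ which is * discrete: for all $x\in X$, $\eta\ge 0$ the set $\{g\in\Gamma: d(x,gx)<\eta\}$ is finite; * slim: for every nontrivial elliptic $g\in\Gamma$ the fixed point set $\mathrm{Fix}(g)$ has empty interior; * almost-cocompact: for every $\delta>0$, $\Gamma$ acts cocompactly on $\{x\in X: d(x,gx)\ge\delta \text{ for all } g\in\Gamma\setminus\{\mathrm{id}\}\}$. For an isometry $g$ let $\ell(g)=\inf_{x}d(x,gx)$ and $\mathrm{Min}(g)=\{x: d(x,gx)=\ell(g)\}$; $g$ is elliptic if $\mathrm{Min}(g)\neq\emptyset$ and $\ell(g)=0$, and hyperbolic if $\mathrm{Min}(g)\neq\emptyset$ and $\ell(g)>0$. Let $\lambda_0$ be any real number and let $\Lambda$ be the set of hyperbolic $g\in\Gamma$ with $\ell(g)\le\lambda_0$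 such that $\mathrm{Min}(g)$ has nonempty interior. Suppose that $X=\bigcup_{g\in\Lambda}\mathrm{Min}(g)$ and that $\langle g,h\rangle$ is virtually cyclic whenever $g,h\in\Lambda$ and $\mathrm{Min}(g)\cap\mathrm{Min}(h)\ne\emptyset$. Then $X$ splits isometrically as $Y\times\mathbb R$ (with the $\ell^2$ product metric) for some metric space $Y$. Moreover, this splitting can be chosen so that, if $\Gamma$ is finitely generated, then $\Gamma$ virtually splits as $\Gamma_Y\times\mathbb Z$, where $\Gamma_Y$ (resp. $\mathbb Z$) acts discretely on $Y$ (resp. $\mathbb R$). Precisely: there are a finite index subgroup $\Gamma_0\le\Gamma$, a discrete group $\Gamma_Y$ of isometries of $Y$, a discrete infinite cyclic group $Z$ of isometries of $\mathbb R$, and an isomorphism $\Gamma_0\cong\Gamma_Y\times Z$ such that each $g\in\Gamma_0$, with components $(g_Y,g_Z)$, acts on $X=Y\times\mathbb R$ by $g(y,t)=(g_Y\,y,\tau_g\,t)$ for some isometry $\tau_g$ of $\mathbb R$, with $\tau_g=g_Z$ whenever $g_Y=\mathrm{id}$. -/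

import Mathlib

open Set Metric

universe u

section CAT0Geometry

variable {X : Type u} [MetricSpace X]

/-- `c` restricted to `[a, b]` is a geodesic, i.e. an isometric embedding of `[a, b]`. -/
def IsGeodesicOn (c : ℝ → X) (a b : ℝ) : Prop :=
  ∀ s ∈ Icc a b, ∀ t ∈ Icc a b, dist (c s) (c t) = |s - t|

/-- `c`, restricted to `[0, d(x, y)]`, is a geodesic from `x` to `y`. -/
def IsGeodesicFromTo (c : ℝ → X) (x y : X) : Prop :=
  IsGeodesicOn c 0 (dist x y) ∧ c 0 = x ∧ c (dist x y) = y

/-- CAT(0) spaces: geodesic spaces all of whose geodesic triangles are thinner than their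
Euclidean comparison triangles. For `p = c s` on a side `[x, y]` and `q = c' t` on a side
`[x, z]`, the comparison points `p'` and `q'` are the points of the Euclidean segments `[x', y']`
and `[x', z']` at distance `s = d(x, p)` and `t = d(x, q)` from `x'`. -/
structure IsCAT0 (X : Type u) [MetricSpace X] : Prop where
  exists_geodesic : ∀ x y : X, ∃ c : ℝ → X, IsGeodesicFromTo c x y
  thin : ∀ (x y z : X) (c c' : ℝ → X), IsGeodesicFromTo c x y → IsGeodesicFromTo c' x z →
    ∀ s ∈ Icc 0 (dist x y), ∀ t ∈ Icc 0 (dist x z),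
    ∀ x' y' z' p' q' : EuclideanSpace ℝ (Fin 2),
      dist x' y' = dist x y → dist y' z' = dist y z → dist x' z' = dist x z →
      p' ∈ segment ℝ x' y' → dist x' p' = s →
      q' ∈ segment ℝ x' z' → dist x' q' = t →
      dist (c s) (c' t) ≤ dist p' q'

/-- Every (nondegenerate) geodesic segment extends to a geodesic line. -/
def IsGeodesicallyComplete (X : Type u) [MetricSpace X] : Prop :=
  ∀ (a b : ℝ) (c : ℝ → X), a < b → IsGeodesicOn c a b →
    ∃ c' : ℝ → X, Isometry c' ∧ EqOn c' c (Icc a b)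

/-- `X` is `P₀`-packed at scale `r₀`: every `r₀`-separated subset of a closed ball of radius
`3 r₀` has at most `P₀` elements. -/
def IsPackedAtScale (X : Type u) [MetricSpace X] (P₀ r₀ : ℝ) : Prop :=
  ∀ (x : X) (S : Set X), S ⊆ closedBall x (3 * r₀) →
    (∀ y ∈ S, ∀ y' ∈ S, y ≠ y' → r₀ < dist y y') → S.Finite ∧ (S.ncard : ℝ) ≤ P₀

/-- The translation length `ℓ(g) = inf_x d(x, g x)`. -/
noncomputable def translationLength (g : X ≃ᵢ X) : ℝ := ⨅ x, dist x (g x)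

/-- The minimum set `Min(g)`. -/
def minSet (g : X ≃ᵢ X) : Set X := {x | dist x (g x) = translationLength g}

/-- `g` is hyperbolic: the infimum `ℓ(g)` is attained and positive. -/
def IsHyperbolicIsom (g : X ≃ᵢ X) : Prop := (minSet g).Nonempty ∧ 0 < translationLength g

/-- `g` is elliptic: the infimum `ℓ(g)` is attained and zero. -/
def IsEllipticIsom (g : X ≃ᵢ X) : Prop := (minSet g).Nonempty ∧ translationLength g = 0

/-- A group of isometries is discrete if for every point `x` and every `η ≥ 0` only finitely many
of its elements displace `x` by less than `η`. -/
def IsDiscreteGroup (Γ : Subgroup (X ≃ᵢ X)) : Prop :=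
  ∀ (x : X) (η : ℝ), 0 ≤ η → {g : X ≃ᵢ X | g ∈ Γ ∧ dist x (g x) < η}.Finite

/-- A group of isometries is slim if the fixed point set of each of its nontrivial elliptic
elements has empty interior. -/
def IsSlimGroup (Γ : Subgroup (X ≃ᵢ X)) : Prop :=
  ∀ g ∈ Γ, g ≠ 1 → IsEllipticIsom g → interior {x | g x = x} = ∅

/-- The systole of `Γ` at `x` (equal to `∞` if `Γ` is trivial). -/
noncomputable def systoleAt (Γ : Subgroup (X ≃ᵢ X)) (x : X) : ENNReal :=
  ⨅ g : X ≃ᵢ X, ⨅ _ : g ∈ Γ, ⨅ _ : g ≠ 1, edist x (g x)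

/-- The `δ`-thick subset. -/
def thickSet (Γ : Subgroup (X ≃ᵢ X)) (δ : ℝ) : Set X :=
  {x | ENNReal.ofReal δ ≤ systoleAt Γ x}

/-- `Γ` is almost-cocompact: for all `δ > 0` it acts cocompactly on the `δ`-thick subset. -/
def IsAlmostCocompact (Γ : Subgroup (X ≃ᵢ X)) : Prop :=
  ∀ δ : ℝ, 0 < δ → ∃ K : Set X, IsCompact K ∧ (⋃ g ∈ Γ, (fun x => g x) '' K) = thickSet Γ δ

/-- The hyperbolic elements of `Γ` of translation length at most `L` whose minimum set has
nonempty interior. -/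
def shortHyperbolics (Γ : Subgroup (X ≃ᵢ X)) (L : ℝ) : Set (X ≃ᵢ X) :=
  {g | g ∈ Γ ∧ IsHyperbolicIsom g ∧ translationLength g ≤ L ∧ (interior (minSet g)).Nonempty}

/-- Virtually cyclic: there is a cyclic subgroup of finite index. -/
def IsVirtuallyCyclic {G : Type*} [Group G] (H : Subgroup G) : Prop :=
  ∃ C : Subgroup G, C ≤ H ∧ IsCyclic C ∧ C.relIndex H ≠ 0

/-- Relative to an isometric splitting `φ : X ≅ Y × ℝ` (with the `ℓ²` product metric), the group
`Γ` virtually splits as `Γ_Y × ℤ`, with `Γ_Y` acting discretely on `Y` and `ℤ` acting discretely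
on `ℝ`.

Here `Γ₀` is a subgroup of finite index in `Γ`, identified by `e` with `ΓY × Z`, where `ΓY` and
`Z` are discrete groups of isometries of `Y` and `ℝ` and `Z` is infinite cyclic. Each `g` in `Γ₀`
preserves the product decomposition; it acts on the factor `Y` through its `ΓY`-component, and the
elements of the factor `Z` act on the factor `ℝ` as what they are. (The factor `ΓY` is not
asked to act trivially on the factor `ℝ`.) -/
def VirtuallySplitsAlong {Y : Type u} [MetricSpace Y] (Γ : Subgroup (X ≃ᵢ X))
    (φ : X ≃ᵢ WithLp 2 (Y × ℝ)) : Prop :=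
  ∃ (Γ₀ : Subgroup (X ≃ᵢ X)) (ΓY : Subgroup (Y ≃ᵢ Y)) (Z : Subgroup (ℝ ≃ᵢ ℝ))
    (e : Γ₀ ≃* ΓY × Z),
    Γ₀ ≤ Γ ∧ Γ₀.relIndex Γ ≠ 0 ∧
    IsDiscreteGroup ΓY ∧ IsDiscreteGroup Z ∧ Nonempty (Z ≃* Multiplicative ℤ) ∧
    ∀ g : Γ₀, ∃ τ : ℝ ≃ᵢ ℝ,
      (∀ x : X, φ ((g : X ≃ᵢ X) x) =
        WithLp.toLp 2 (((e g).1 : Y ≃ᵢ Y) (φ x).fst, τ (φ x).snd)) ∧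
      ((e g).1 = 1 → τ = ((e g).2 : ℝ ≃ᵢ ℝ))

end CAT0Geometry

open Filter Topology

/-! Two elements of `shortHyperbolics Γ lam₀` whose minimum sets meet generate a virtually cyclic
group and have infinite order, so they share a nontrivial power. The minimum sets form a locally
finite closed cover of the connected space `X`, so this relation spreads to all pairs
(`haveCommonPower_of_cover`). Fix one such element `g₀`. Every point then lies on an axis of some
`g` in the family, and, after a choice of direction, this axis is translated forward by a positive
power of `g₀`. Two such lines have periodic convex mutual distance, hence are parallel. Flat strips
between them have additive shifts, which provide the coordinate on the `ℝ` factor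
(`ParallelFamily.exists_splitting`).

For the group, conjugates of `g₀` remain in the family, so each element of `Γ` sends some power of
`g₀` to itself or its inverse under conjugation. Finite generation gives one exponent `N` for all of
`Γ`. Put `z = g₀ ^ N`. A priori `z` could still act nontrivially on `Y`. However, the sublevel set
of its displacement at height `N * l`, where `l` is the translation length of `g₀`, is nonempty,
closed, convex and `Γ`-invariant, and `Γ` admits no proper such subset
(`eq_univ_of_invariant_convex`). Hence `z` is a pure translation. Its centralizer in `Γ` has finite
index and acts by isometries of `Y` and translations of `ℝ`. An integral character with value `1` at
`z`, on a further finite index subgroup, splits off the cyclic factor, and discreteness makes the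
decomposition faithful (`virtuallySplitsAlong_of_product_action`). -/

/-! ### Comparison triangles and CAT(0) inequalities -/

theorem exists_comparison_triangle {a b c : ℝ} (ha : 0 ≤ a) (hb : 0 ≤ b)
    (h₁ : c ≤ a + b) (h₂ : a ≤ b + c) (h₃ : b ≤ a + c) :
    ∃ x y z : EuclideanSpace ℝ (Fin 2), dist x y = a ∧ dist y z = c ∧ dist x z = b := by
  have hc : 0 ≤ c := by linarith
  rcases ha.eq_or_lt with rfl | ha'
  · have : b = c := by linarith
    subst this
    refine ⟨0, 0, !₂[b, 0], by simp, ?_, ?_⟩ <;>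
      simp [EuclideanSpace.dist_eq, Real.dist_eq, Real.sqrt_sq hb]
  -- By the law of cosines, `u` is the abscissa of the third vertex when the side of length `a` lies
  -- on the first axis.
  · set u := (a ^ 2 + b ^ 2 - c ^ 2) / (2 * a) with hu
    have hua : 2 * a * u = a ^ 2 + b ^ 2 - c ^ 2 := by rw [hu]; field_simp
    have hub : u ^ 2 ≤ b ^ 2 := by
      have h1 : 0 ≤ b - u := by
        by_contra! h
        nlinarith [mul_pos ha' (show 0 < u - b by linarith),
          mul_nonneg (show 0 ≤ c - (a - b) by linarith) (show 0 ≤ c + (a - b) by linarith)]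
      have h2 : 0 ≤ b + u := by
        by_contra! h
        nlinarith [mul_pos ha' (show 0 < -u - b by linarith),
          mul_nonneg (show 0 ≤ a + b - c by linarith) (show 0 ≤ a + b + c by linarith)]
      nlinarith [mul_nonneg h1 h2]
    refine ⟨0, !₂[a, 0], !₂[u, Real.sqrt (b ^ 2 - u ^ 2)], ?_, ?_, ?_⟩
    · simp [EuclideanSpace.dist_eq, Real.dist_eq, Real.sqrt_sq ha]
    · rw [EuclideanSpace.dist_eq, ← Real.sqrt_sq hc]
      congr 1
      simp only [Fin.sum_univ_two, Real.dist_eq, sq_abs]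
      simp only [Matrix.cons_val_zero, Matrix.cons_val_one, zero_sub, neg_sq]
      rw [Real.sq_sqrt (by linarith)]
      nlinarith
    · rw [EuclideanSpace.dist_eq]
      simp [Fin.sum_univ_two, Real.dist_eq, sq_abs, Real.sq_sqrt (sub_nonneg.2 hub),
        Real.sqrt_sq hb]

/-- `m` is a metric midpoint of `y` and `z`. -/
def IsMetricMidpoint {X : Type u} [MetricSpace X] (m y z : X) : Prop :=
  dist y m = dist y z / 2 ∧ dist m z = dist y z / 2

namespace IsMetricMidpoint

variable {X : Type u} [MetricSpace X]

theorem symm {m y z : X} (h : IsMetricMidpoint m y z) : IsMetricMidpoint m z y :=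
  ⟨by rw [dist_comm, h.2, dist_comm], by rw [dist_comm, h.1, dist_comm]⟩

theorem map {m y z : X} (h : IsMetricMidpoint m y z) (g : X ≃ᵢ X) :
    IsMetricMidpoint (g m) (g y) (g z) := by
  simpa [IsMetricMidpoint, g.dist_eq] using h

end IsMetricMidpoint

theorem Isometry.isMetricMidpoint {X : Type u} [MetricSpace X] {c : ℝ → X} (hc : Isometry c)
    (s t : ℝ) : IsMetricMidpoint (c s) (c (s - t)) (c (s + t)) := by
  simp only [IsMetricMidpoint, hc.dist_eq, Real.dist_eq]
  constructor <;> rw [show s - t - (s + t) = -(2 * t) by ring, abs_neg, abs_mul] <;>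
    norm_num

namespace IsCAT0

variable {X : Type u} [MetricSpace X]

theorem exists_triangle (x y z : X) : ∃ x' y' z' : EuclideanSpace ℝ (Fin 2),
    dist x' y' = dist x y ∧ dist y' z' = dist y z ∧ dist x' z' = dist x z := by
  refine exists_comparison_triangle dist_nonneg dist_nonneg ?_ ?_ ?_
  · exact dist_triangle_left _ _ _
  · rw [dist_comm y z]; exact dist_triangle _ _ _
  · exact dist_triangle _ _ _

theorem geodesic_midpoint {c : ℝ → X} {y z : X} (hc : IsGeodesicFromTo c y z) :
    IsMetricMidpoint (c (dist y z / 2)) y z := by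
  obtain ⟨h, h0, h1⟩ := hc
  have hd : 0 ≤ dist y z := dist_nonneg
  constructor
  · nth_rw 1 [← h0]
    rw [h 0 ⟨le_rfl, hd⟩ _ ⟨by linarith, by linarith⟩, zero_sub, abs_neg,
      abs_of_nonneg (by linarith)]
  · nth_rw 2 [← h1]
    rw [h _ ⟨by linarith, by linarith⟩ _ ⟨hd, le_rfl⟩, abs_of_nonpos (by linarith)]
    ring

/-- Thinness is used with one of the two points at the vertex `x`; the Euclidean median formula
evaluates the comparison distance. -/
theorem cn_geodesic (h : IsCAT0 X) (x : X) {y z : X} {c : ℝ → X} (hc : IsGeodesicFromTo c y z) :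
    dist x (c (dist y z / 2)) ^ 2 ≤
      dist x y ^ 2 / 2 + dist x z ^ 2 / 2 - dist y z ^ 2 / 4 := by
  obtain ⟨b, hb⟩ := h.exists_geodesic y x
  obtain ⟨y', x', z', h1, h2, h3⟩ := exists_triangle y x z
  have hd : 0 ≤ dist y z := dist_nonneg
  have key := h.thin y x z b c hb hc (dist y x) ⟨dist_nonneg, le_rfl⟩ (dist y z / 2)
    ⟨by linarith, by linarith⟩ y' x' z' x' (midpoint ℝ y' z') h1 h2 h3
    (right_mem_segment ℝ _ _) h1 (midpoint_mem_segment _ _)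
    (by rw [dist_left_midpoint, h3]; norm_num; ring)
  rw [hb.2.2] at key
  have apo := EuclideanGeometry.dist_sq_add_dist_sq_eq_two_mul_dist_midpoint_sq_add_half_dist_sq
    x' y' z'
  rw [dist_comm x' y', h1, h2, h3, dist_comm y x] at apo
  have : dist x (c (dist y z / 2)) ^ 2 ≤ dist x' (midpoint ℝ y' z') ^ 2 := by gcongr
  linarith

theorem eq_midpoint (h : IsCAT0 X) {y z m : X} {c : ℝ → X} (hc : IsGeodesicFromTo c y z)
    (hm : IsMetricMidpoint m y z) : m = c (dist y z / 2) := by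
  have := h.cn_geodesic m hc
  rw [dist_comm m y, hm.1, hm.2] at this
  exact dist_eq_zero.1 (pow_eq_zero_iff two_ne_zero |>.1 (le_antisymm (by linarith) (sq_nonneg _)))

/-- The CN inequality of Bruhat and Tits. -/
theorem cn (h : IsCAT0 X) (x : X) {m y z : X} (hm : IsMetricMidpoint m y z) :
    dist x m ^ 2 ≤ dist x y ^ 2 / 2 + dist x z ^ 2 / 2 - dist y z ^ 2 / 4 := by
  obtain ⟨c, hc⟩ := h.exists_geodesic y z
  rw [h.eq_midpoint hc hm]
  exact h.cn_geodesic x hc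

theorem exists_midpoint (h : IsCAT0 X) (y z : X) : ∃ m, IsMetricMidpoint m y z := by
  obtain ⟨c, hc⟩ := h.exists_geodesic y z
  exact ⟨_, geodesic_midpoint hc⟩

theorem dist_midpoints_le_half (h : IsCAT0 X) {x y z p q : X} (hp : IsMetricMidpoint p x y)
    (hq : IsMetricMidpoint q x z) : dist p q ≤ dist y z / 2 := by
  obtain ⟨b, hb⟩ := h.exists_geodesic x y
  obtain ⟨c, hc⟩ := h.exists_geodesic x z
  obtain ⟨x', y', z', h1, h2, h3⟩ := exists_triangle x y z
  have hd : 0 ≤ dist x y := dist_nonneg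
  have hd' : 0 ≤ dist x z := dist_nonneg
  rw [h.eq_midpoint hb hp, h.eq_midpoint hc hq]
  refine (h.thin x y z b c hb hc (dist x y / 2) ⟨by linarith, by linarith⟩ (dist x z / 2)
    ⟨by linarith, by linarith⟩ x' y' z' (midpoint ℝ x' y') (midpoint ℝ x' z') h1 h2 h3
    (midpoint_mem_segment _ _) (by rw [dist_left_midpoint, h1]; norm_num; ring)
    (midpoint_mem_segment _ _) (by rw [dist_left_midpoint, h3]; norm_num; ring)).trans ?_
  have := dist_midpoint_midpoint_le x' y' x' z'
  rwa [dist_self, zero_add, h2] at this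

/-- The midpoint of the diagonal from `x` to `y'` splits the estimate into two triangles. -/
theorem dist_midpoints_le (h : IsCAT0 X) {x y x' y' p p' : X} (hp : IsMetricMidpoint p x y)
    (hp' : IsMetricMidpoint p' x' y') : dist p p' ≤ (dist x x' + dist y y') / 2 := by
  obtain ⟨q, hq⟩ := h.exists_midpoint x y'
  have h1 := h.dist_midpoints_le_half hp hq
  have h2 := h.dist_midpoints_le_half hq.symm hp'.symm
  linarith [dist_triangle p q p']

/-- CAT(0) spaces have roundness two. -/
theorem quadrilateral (h : IsCAT0 X) (x y z w : X) :
    dist x z ^ 2 + dist y w ^ 2 ≤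
      dist x y ^ 2 + dist y z ^ 2 + dist z w ^ 2 + dist w x ^ 2 := by
  obtain ⟨m, hm⟩ := h.exists_midpoint x z
  have h1 := h.cn y hm
  have h2 := h.cn w hm
  have h3 : dist y w ^ 2 ≤ (dist y m + dist w m) ^ 2 := by
    gcongr
    exact dist_triangle_right _ _ _
  rw [dist_comm y x] at h1
  rw [dist_comm w z] at h2
  nlinarith [sq_nonneg (dist y m - dist w m)]

theorem preconnectedSpace (h : IsCAT0 X) : PreconnectedSpace X := by
  refine ⟨isPreconnected_of_forall_pair fun x _ y _ => ?_⟩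
  obtain ⟨c, hc, h0, h1⟩ := h.exists_geodesic x y
  refine ⟨c '' Icc 0 (dist x y), subset_univ _, ⟨0, ⟨le_rfl, dist_nonneg⟩, h0⟩,
    ⟨_, ⟨dist_nonneg, le_rfl⟩, h1⟩, isPreconnected_Icc.image _ ?_⟩
  refine LipschitzOnWith.continuousOn (K := 1) (LipschitzOnWith.of_dist_le_mul fun s hs t ht => ?_)
  rw [hc s hs t ht, NNReal.coe_one, one_mul, Real.dist_eq]

end IsCAT0

/-! ### Parallel lines and flat strips -/

/-- A continuous function on `ℝ` satisfying `k (s + u) + k (s - u) = 2 * k s` is affine. -/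
theorem exists_affine_of_jensen {k : ℝ → ℝ} (hk : Continuous k)
    (h : ∀ s u, k (s + u) + k (s - u) = 2 * k s) : ∃ b, ∀ s, k s = k 0 + b * s := by
  have hadd : ∀ a b, (k (a + b) - k 0) = (k a - k 0) + (k b - k 0) := by
    intro a b
    have h1 := h ((a + b) / 2) ((a - b) / 2)
    have h2 := h ((a + b) / 2) ((a + b) / 2)
    rw [show (a + b) / 2 + (a - b) / 2 = a by ring, show (a + b) / 2 - (a - b) / 2 = b by ring] at h1
    rw [add_halves, sub_self] at h2
    linarith
  let K : ℝ →+ ℝ := ⟨⟨fun a => k a - k 0, by simp⟩, hadd⟩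
  have hK : Continuous K := hk.sub continuous_const
  refine ⟨K 1, fun s => ?_⟩
  have := map_real_smul K hK s 1
  simp only [smul_eq_mul, mul_one] at this
  have h2 : K s = k s - k 0 := rfl
  linarith

/-- A continuous periodic midpoint-convex function is constant. -/
theorem eq_of_periodic_of_midpoint_convex {F : ℝ → ℝ} {P : ℝ} (hP : 0 < P)
    (hF : Continuous F) (hper : Function.Periodic F P)
    (hconv : ∀ t u, F t ≤ (F (t - u) + F (t + u)) / 2) (s t : ℝ) : F s = F t := by
  obtain ⟨t₀, -, ht₀⟩ := (isCompact_Icc (a := 0) (b := P)).exists_isMaxOn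
    ⟨0, le_rfl, hP.le⟩ hF.continuousOn
  have hmax : ∀ t, F t ≤ F t₀ := fun t => by
    obtain ⟨y, hy, hty⟩ := hper.exists_mem_Ico₀ hP t
    rw [hty]
    exact ht₀ ⟨hy.1, hy.2.le⟩
  -- Midpoint convexity centred at the maximum point `t₀` forces equality at every point and its
  -- reflection.
  have key : ∀ t, F t = F t₀ := fun t => by
    have h1 := hconv t₀ (t - t₀)
    rw [add_sub_cancel] at h1
    linarith [hmax t, hmax (t₀ - (t - t₀))]
  rw [key s, key t]

/-- Two lines move at constant distance from each other. -/
def AreParallel {X : Type u} [MetricSpace X] (c c' : ℝ → X) : Prop :=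
  ∀ t s, dist (c t) (c' (t + s)) = dist (c 0) (c' s)

namespace IsCAT0

variable {X : Type u} [MetricSpace X]

theorem areParallel_of_periodic (h : IsCAT0 X) {c c' : ℝ → X} (hc : Isometry c)
    (hc' : Isometry c') {P : ℝ} (hP : 0 < P)
    (hper : ∀ s t, dist (c (s + P)) (c' (t + P)) = dist (c s) (c' t)) : AreParallel c c' := by
  intro t s
  have := eq_of_periodic_of_midpoint_convex (F := fun t => dist (c t) (c' (t + s))) hP
    (hc.continuous.dist (hc'.continuous.comp (continuous_id.add continuous_const)))
    (fun t => by simp only; rw [← hper t, add_right_comm])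
    (fun t u => by
      have := h.dist_midpoints_le (hc.isMetricMidpoint t u) (hc'.isMetricMidpoint (t + s) u)
      rwa [show t + s - u = t - u + s by ring, show t + s + u = t + u + s by ring] at this) t 0
  simpa using this

/-- The flat strip theorem. -/
theorem flat_strip (h : IsCAT0 X) {c c' : ℝ → X} (hc : Isometry c) (hc' : Isometry c')
    (hp : AreParallel c c') :
    ∃ β ρ : ℝ, 0 ≤ ρ ∧ ∀ u v, dist (c u) (c' v) ^ 2 = (v - u + β) ^ 2 + ρ := by
  set f : ℝ → ℝ := fun s => dist (c 0) (c' s) ^ 2 with hf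
  have hpf : ∀ t s, dist (c t) (c' s) ^ 2 = f (s - t) := fun t s => by
    rw [hf]; simp only; rw [← hp t (s - t), add_sub_cancel]
  have hfu : ∀ s u, f (s + u) + f (s - u) = 2 * f s + 2 * u ^ 2 := by
    intro s u
    -- For the upper bound, `f (s + u)` and `f (s - u)` are the squared diagonals of a quadrilateral
    -- with two opposite sides of length `|u|`; the lower bound is the CN inequality. Together they
    -- make `f s - s ^ 2` affine.
    apply le_antisymm
    · have := h.quadrilateral (c 0) (c u) (c' (s + u)) (c' s)
      rw [dist_comm (c' s), hpf, hpf, hpf, hpf, hc.dist_eq, hc'.dist_eq, Real.dist_eq,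
        Real.dist_eq, sq_abs, sq_abs] at this
      rw [sub_zero, add_sub_cancel_left, add_sub_cancel_right, zero_sub, neg_sq, sub_zero] at this
      linarith
    · have := h.cn (c 0) (hc'.isMetricMidpoint s u)
      rw [hc'.dist_eq, Real.dist_eq, sq_abs] at this
      simp only [hf]
      nlinarith
  have hfc : Continuous f := (continuous_const.dist hc'.continuous).pow 2
  obtain ⟨b, hb⟩ := exists_affine_of_jensen (k := fun s => f s - s ^ 2)
    (hfc.sub (continuous_id.pow 2)) (fun s u => by nlinarith [hfu s u])
  have hfs : ∀ s, f s = (s + b / 2) ^ 2 + (f 0 - b ^ 2 / 4) := fun s => by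
    have := hb s
    nlinarith
  refine ⟨b / 2, f 0 - b ^ 2 / 4, ?_, fun u v => by rw [hpf, hfs]⟩
  have h0 : 0 ≤ f (-(b / 2)) := sq_nonneg _
  rw [hfs, neg_add_cancel] at h0
  simpa using h0

end IsCAT0

/-! ### Splitting along a family of parallel lines -/

theorem tendsto_sqrt_sub {β ρ : ℝ} (hρ : 0 ≤ ρ) {d : ℝ → ℝ} (hd : ∀ s, 0 ≤ d s)
    (h : ∀ s, d s ^ 2 = (s + β) ^ 2 + ρ) : Tendsto (fun s => d s - s) atTop (𝓝 β) := by
  have hlim : Tendsto (fun s : ℝ => β + ρ * (s + β)⁻¹) atTop (𝓝 (β + ρ * 0)) :=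
    tendsto_const_nhds.add (tendsto_const_nhds.mul
      (tendsto_inv_atTop_zero.comp (tendsto_atTop_add_const_right _ _ tendsto_id)))
  rw [mul_zero, add_zero] at hlim
  refine tendsto_of_tendsto_of_tendsto_of_le_of_le' tendsto_const_nhds hlim ?_ ?_
  · filter_upwards with s
    have : s + β ≤ d s := (abs_le_of_sq_le_sq' (by rw [h]; linarith) (hd s)).2
    linarith
  · filter_upwards [eventually_gt_atTop (-β)] with s hs
    have hs' : 0 < s + β := by linarith
    have h1 : d s ≤ s + β + ρ * (s + β)⁻¹ := by
      have h2 : 0 ≤ ρ * (s + β)⁻¹ := by positivity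
      refine abs_le_of_sq_le_sq' ?_ (by linarith) |>.2
      have h3 : (s + β) * (ρ * (s + β)⁻¹) = ρ := by field_simp
      rw [h]
      nlinarith
    linarith

theorem WithLp.prod_dist_eq_sqrt {Y Z : Type*} [MetricSpace Y] [MetricSpace Z]
    (p q : WithLp 2 (Y × Z)) :
    dist p q = Real.sqrt (dist p.fst q.fst ^ 2 + dist p.snd q.snd ^ 2) := by
  rw [WithLp.prod_dist_eq_add (by norm_num), Real.sqrt_eq_rpow]
  norm_num

/-- A family of pairwise parallel lines through every point of a space. -/
structure ParallelFamily (X : Type u) [MetricSpace X] where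
  /-- the lines of the family -/
  lines : Set (ℝ → X)
  isometry : ∀ c ∈ lines, Isometry c
  parallel : ∀ c ∈ lines, ∀ c' ∈ lines, AreParallel c c'
  exists_line : ∀ x, ∃ c ∈ lines, c 0 = x

namespace ParallelFamily

variable {X : Type u} [MetricSpace X] (𝓛 : ParallelFamily X)

/-- The shift `β c c'` is the limit of `dist (c 0) (c' s) - s`, as for a Busemann function. The path
from `c 0` through `c' s` to `c'' (2 * s)` makes `β` subadditive; antisymmetry upgrades this to
additivity, which says that parallelism strips have no holonomy. -/
theorem exists_shift_cocycle (h : IsCAT0 X) : ∃ β ρ : (ℝ → X) → (ℝ → X) → ℝ,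
    (∀ c ∈ 𝓛.lines, ∀ c' ∈ 𝓛.lines, 0 ≤ ρ c c' ∧
      ∀ u v, dist (c u) (c' v) ^ 2 = (v - u + β c c') ^ 2 + ρ c c') ∧
    (∀ c ∈ 𝓛.lines, ∀ c' ∈ 𝓛.lines, ∀ c'' ∈ 𝓛.lines, β c c'' = β c c' + β c' c'') := by
  have : ∀ c c' : ℝ → X, ∃ β ρ : ℝ, c ∈ 𝓛.lines → c' ∈ 𝓛.lines →
      0 ≤ ρ ∧ ∀ u v, dist (c u) (c' v) ^ 2 = (v - u + β) ^ 2 + ρ := fun c c' => by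
    by_cases hc : c ∈ 𝓛.lines ∧ c' ∈ 𝓛.lines
    · obtain ⟨β, ρ, H⟩ := h.flat_strip (𝓛.isometry _ hc.1) (𝓛.isometry _ hc.2)
        (𝓛.parallel _ hc.1 _ hc.2)
      exact ⟨β, ρ, fun _ _ => H⟩
    · exact ⟨0, 0, fun h1 h2 => (hc ⟨h1, h2⟩).elim⟩
  choose β ρ hβ using this
  have symm : ∀ c ∈ 𝓛.lines, ∀ c' ∈ 𝓛.lines, β c' c = -β c c' := by
    intro c hc c' hc'
    have h1 := (hβ c c' hc hc').2
    have h2 := (hβ c' c hc' hc).2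
    have e1 := h1 0 0
    have e2 := h1 0 1
    have e3 := h2 0 0
    have e4 := h2 1 0
    rw [dist_comm] at e3 e4
    nlinarith
  have lim : ∀ c ∈ 𝓛.lines, ∀ c' ∈ 𝓛.lines,
      Tendsto (fun s => dist (c 0) (c' s) - s) atTop (𝓝 (β c c')) := fun c hc c' hc' =>
    tendsto_sqrt_sub (hβ c c' hc hc').1 (fun _ => dist_nonneg) fun s => by
      rw [(hβ c c' hc hc').2, sub_zero]
  have le : ∀ c ∈ 𝓛.lines, ∀ c' ∈ 𝓛.lines, ∀ c'' ∈ 𝓛.lines,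
      β c c'' ≤ β c c' + β c' c'' := by
    intro c hc c' hc' c'' hc''
    have h2 : Tendsto (fun s : ℝ => 2 * s) atTop atTop :=
      tendsto_id.const_mul_atTop two_pos
    refine le_of_tendsto_of_tendsto ((lim c hc c'' hc'').comp h2)
      ((lim c hc c' hc').add (lim c' hc' c'' hc'')) (Eventually.of_forall fun s => ?_)
    have h3 := 𝓛.parallel c' hc' c'' hc'' s s
    have h4 := dist_triangle (c 0) (c' s) (c'' (s + s))
    simp only [Function.comp, two_mul]
    linarith
  refine ⟨β, ρ, fun c hc c' hc' => hβ c c' hc hc', fun c hc c' hc' c'' hc'' => ?_⟩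
  refine le_antisymm (le c hc c' hc' c'' hc'') ?_
  have := le c'' hc'' c' hc' c hc
  rw [symm c hc c'' hc'', symm c hc c' hc', symm c' hc' c'' hc''] at this
  linarith

/-- A space which is the union of a family of parallel lines splits. -/
theorem exists_splitting [Nonempty X] (h : IsCAT0 X) :
    ∃ (Y : Type u) (_ : MetricSpace Y) (φ : X ≃ᵢ WithLp 2 (Y × ℝ)),
      ∀ c ∈ 𝓛.lines, ∀ t, φ (c t) = WithLp.toLp 2 ((φ (c 0)).fst, (φ (c 0)).snd + t) := by
  obtain ⟨β, ρ, hd, hadd⟩ := 𝓛.exists_shift_cocycle h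
  choose L hL hL0 using 𝓛.exists_line
  let o : ℝ → X := L (Classical.arbitrary X)
  have ho : o ∈ 𝓛.lines := hL _
  -- lines meeting in a point agree up to a shift
  have uniq : ∀ c ∈ 𝓛.lines, ∀ c' ∈ 𝓛.lines, ∀ u, c' 0 = c u →
      β o c' = β o c + u ∧ ∀ v, c' v = c (u + v) := by
    intro c hc c' hc' u hu
    obtain ⟨hρ, hd⟩ := hd c hc c' hc'
    have h0 := hd u 0
    rw [hu, dist_self] at h0
    have hβ : β c c' = u := by nlinarith
    have hρ0 : ρ c c' = 0 := by nlinarith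
    refine ⟨by rw [hadd o ho c hc c' hc', hβ], fun v => ?_⟩
    have h1 := hd (u + v) v
    rw [hβ, hρ0, show v - (u + v) + u = 0 by ring] at h1
    exact (dist_eq_zero.1 (by simpa using h1)).symm
  -- `T` is the height relative to the reference line `o`. It grows at unit speed along every line
  -- of the family, so each line meets the level set `Y` of height zero exactly once.
  let T : X → ℝ := fun x => β o (L x)
  have hT : ∀ c ∈ 𝓛.lines, ∀ u, T (c u) = β o c + u ∧ ∀ v, L (c u) v = c (u + v) :=
    fun c hc u => uniq c hc _ (hL _) u (hL0 _)
  have hTL : ∀ x u, T (L x u) = T x + u := fun x u => (hT _ (hL x) u).1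
  have hLL : ∀ x u v, L (L x u) v = L x (u + v) := fun x u => (hT _ (hL x) u).2
  let Y := {x : X // T x = 0}
  let φ : X ≃ WithLp 2 (Y × ℝ) :=
    { toFun := fun x => WithLp.toLp 2 (⟨L x (-T x), by rw [hTL, add_neg_cancel]⟩, T x)
      invFun := fun p => L p.fst p.snd
      left_inv := fun x => by
        change L (L x (-T x)) (T x) = x
        rw [hLL, neg_add_cancel, hL0]
      right_inv := fun p => by
        have h1 : T (L p.fst p.snd) = p.snd := by rw [hTL, p.fst.2, zero_add]
        refine (WithLp.ofLp_injective 2) (Prod.ext (Subtype.ext ?_) h1)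
        change L (L p.fst p.snd) (-T (L p.fst p.snd)) = p.fst
        rw [hLL, h1, add_neg_cancel, hL0] }
  have hφ : Isometry φ := by
    refine Isometry.of_dist_eq fun x y => ?_
    refine (WithLp.prod_dist_eq_sqrt _ _).trans ?_
    rw [← Real.sqrt_sq (dist_nonneg (x := x) (y := y))]
    congr 1
    change dist (L x (-T x)) (L y (-T y)) ^ 2 + dist (T x) (T y) ^ 2 = dist x y ^ 2
    have h1 := (hd _ (hL x) _ (hL y)).2
    have h2 := h1 0 0
    rw [hL0, hL0] at h2
    have h3 : T y = T x + β (L x) (L y) := hadd o ho _ (hL x) _ (hL y)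
    rw [h1, h2, Real.dist_eq, sq_abs, h3]
    ring
  refine ⟨Y, inferInstance, ⟨φ, hφ⟩, fun c hc t => ?_⟩
  refine (WithLp.ofLp_injective 2) (Prod.ext (Subtype.ext ?_) ?_)
  · change L (c t) (-T (c t)) = L (c 0) (-T (c 0))
    rw [(hT c hc t).2, (hT c hc 0).2, (hT c hc t).1, (hT c hc 0).1]
    congr 1
    ring
  · change T (c t) = T (c 0) + t
    rw [(hT c hc t).1, (hT c hc 0).1, add_zero]

end ParallelFamily

/-! ### Common powers -/

/-- Two group elements have a common nontrivial power. -/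
def HaveCommonPower {G : Type*} [Group G] (g h : G) : Prop :=
  ∃ a b : ℤ, a ≠ 0 ∧ b ≠ 0 ∧ g ^ a = h ^ b

namespace HaveCommonPower

variable {G : Type*} [Group G] {g h k : G}

theorem symm : HaveCommonPower g h → HaveCommonPower h g :=
  fun ⟨a, b, ha, hb, e⟩ => ⟨b, a, hb, ha, e.symm⟩

theorem trans : HaveCommonPower g h → HaveCommonPower h k → HaveCommonPower g k :=
  fun ⟨a, b, ha, hb, e⟩ ⟨c, d, hc, hd, e'⟩ => ⟨a * c, d * b, mul_ne_zero ha hc,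
    mul_ne_zero hd hb, by rw [zpow_mul, e, ← zpow_mul, mul_comm, zpow_mul, e', ← zpow_mul]⟩

end HaveCommonPower

/-- Positive powers of `g` and `h` fall into one cyclic group, as powers of its generator with
exponents `i` and `j`. Infinite order keeps `i` and `j` nonzero, and cross-multiplying exponents
gives the common power. -/
theorem IsVirtuallyCyclic.haveCommonPower {G : Type*} [Group G] {g h : G}
    (H : IsVirtuallyCyclic (Subgroup.closure {g, h})) (hg : ∀ n : ℕ, 0 < n → g ^ n ≠ 1)
    (hh : ∀ n : ℕ, 0 < n → h ^ n ≠ 1) : HaveCommonPower g h := by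
  obtain ⟨C, hC, hcyc, hidx⟩ := H
  obtain ⟨n, hn, -, hgn⟩ := Subgroup.exists_pow_mem_of_relIndex_ne_zero hidx
    (Subgroup.subset_closure (by simp : g ∈ ({g, h} : Set G)))
  obtain ⟨m, hm, -, hhm⟩ := Subgroup.exists_pow_mem_of_relIndex_ne_zero hidx
    (Subgroup.subset_closure (by simp : h ∈ ({g, h} : Set G)))
  obtain ⟨z, hz⟩ := (Subgroup.isCyclic_iff_exists_zpowers_eq_top C).1 hcyc
  rw [← hz] at hgn hhm
  obtain ⟨i, hi⟩ := Subgroup.mem_zpowers_iff.1 hgn.1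
  obtain ⟨j, hj⟩ := Subgroup.mem_zpowers_iff.1 hhm.1
  have hi0 : i ≠ 0 := by
    rintro rfl
    exact hg n hn (by rw [← hi, zpow_zero])
  have hj0 : j ≠ 0 := by
    rintro rfl
    exact hh m hm (by rw [← hj, zpow_zero])
  refine ⟨n * j, m * i, mul_ne_zero (by omega) hj0, mul_ne_zero (by omega) hi0, ?_⟩
  rw [zpow_mul, zpow_mul, zpow_natCast, zpow_natCast, ← hi, ← hj, ← zpow_mul, ← zpow_mul,
    mul_comm]

/-! ### Axes of hyperbolic isometries -/

section Axes

variable {X : Type u} [MetricSpace X]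

theorem translationLength_le (g : X ≃ᵢ X) (x : X) : translationLength g ≤ dist x (g x) :=
  ciInf_le ⟨0, by rintro _ ⟨y, rfl⟩; exact dist_nonneg⟩ x

theorem dist_pow_apply_le (g : X ≃ᵢ X) (x : X) (n : ℕ) :
    dist x ((g ^ n) x) ≤ n * dist x (g x) := by
  induction n with
  | zero => simp
  | succ n ih =>
    have h1 : dist ((g ^ n) x) ((g ^ (n + 1)) x) = dist x (g x) := by
      rw [pow_succ, IsometryEquiv.mul_apply, IsometryEquiv.dist_eq]
    push_cast
    linarith [dist_triangle x ((g ^ n) x) ((g ^ (n + 1)) x)]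

/-- If `m` is the midpoint of `y` and `g y`, then `m` and `g m` are midpoints of two sides of the
triangle `y, g y, g (g y)`. -/
theorem IsCAT0.two_mul_le_dist_sq (h : IsCAT0 X) {g : X ≃ᵢ X} {l : ℝ}
    (hl : ∀ y, l ≤ dist y (g y)) (y : X) : 2 * l ≤ dist y ((g * g) y) := by
  obtain ⟨m, hm⟩ := h.exists_midpoint y (g y)
  have := h.dist_midpoints_le_half hm.symm (hm.map g)
  rw [IsometryEquiv.mul_apply]
  linarith [hl m]

/-- Doubling gives the lower bound for exponents `2 ^ k`. For general `n`, a shortfall at `n` would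
persist at `2 ^ n ≥ n`, since the remaining steps cost at most the translation length each. -/
theorem IsCAT0.dist_pow_apply (h : IsCAT0 X) {g : X ≃ᵢ X} {x : X} (hx : x ∈ minSet g) (n : ℕ) :
    dist x ((g ^ n) x) = n * translationLength g := by
  have hx' : dist x (g x) = translationLength g := hx
  have h2 : ∀ k : ℕ, ∀ y, 2 ^ k * translationLength g ≤ dist y ((g ^ (2 ^ k)) y) := by
    intro k
    induction k with
    | zero => simpa using translationLength_le g
    | succ k ih =>
      intro y
      have := h.two_mul_le_dist_sq ih y
      rw [pow_succ, pow_succ, pow_mul, pow_two]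
      linarith
  refine le_antisymm (hx' ▸ dist_pow_apply_le g x n) ?_
  have h3 : n ≤ 2 ^ n := Nat.lt_two_pow_self.le
  have h4 : dist ((g ^ n) x) ((g ^ (2 ^ n)) x) ≤ ((2 ^ n - n : ℕ) : ℝ) * translationLength g := by
    rw [show g ^ 2 ^ n = g ^ n * g ^ (2 ^ n - n) by rw [← pow_add, Nat.add_sub_cancel' h3],
      IsometryEquiv.mul_apply, IsometryEquiv.dist_eq, ← hx']
    exact dist_pow_apply_le g x _
  rw [Nat.cast_sub h3] at h4
  push_cast at h4
  linarith [dist_triangle x ((g ^ n) x) ((g ^ (2 ^ n)) x), h2 n x]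

theorem IsCAT0.pow_ne_one (h : IsCAT0 X) {g : X ≃ᵢ X} (hg : IsHyperbolicIsom g) (n : ℕ)
    (hn : 0 < n) : g ^ n ≠ 1 := by
  intro h1
  obtain ⟨⟨x, hx⟩, hpos⟩ := hg
  have := h.dist_pow_apply hx n
  rw [h1, show (1 : X ≃ᵢ X) x = x from rfl, dist_self] at this
  have hn' : (0 : ℝ) < n := by exact_mod_cast hn
  nlinarith [mul_pos hn' hpos]

theorem IsCAT0.dist_zpow_zpow (h : IsCAT0 X) {g : X ≃ᵢ X} {x : X} (hx : x ∈ minSet g) {m n : ℤ}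
    (hmn : m ≤ n) : dist ((g ^ m) x) ((g ^ n) x) = (n - m) * translationLength g := by
  obtain ⟨k, rfl⟩ := Int.le.dest hmn
  rw [zpow_add, IsometryEquiv.mul_apply, IsometryEquiv.dist_eq, zpow_natCast,
    h.dist_pow_apply hx]
  push_cast
  ring

theorem IsCAT0.exists_axis (h : IsCAT0 X) {g : X ≃ᵢ X} (hg : IsHyperbolicIsom g) {x : X}
    (hx : x ∈ minSet g) :
    ∃ c : ℝ → X, Isometry c ∧ c 0 = x ∧ ∀ t, g (c t) = c (t + translationLength g) := by
  obtain ⟨γ, hγ, hγ0, hγ1⟩ := h.exists_geodesic x (g x)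
  have hx' : dist x (g x) = translationLength g := hx
  rw [hx'] at hγ hγ1
  have hl := hg.2
  set l := translationLength g with hl_def
  -- The candidate axis concatenates the `g`-translates of a geodesic from `x` to `g x`.
  set c : ℝ → X := fun t => (g ^ ⌊t / l⌋) (γ (t - ⌊t / l⌋ * l)) with hc
  have hfl : ∀ t, 0 ≤ t - ⌊t / l⌋ * l ∧ t - ⌊t / l⌋ * l < l := fun t => by
    have h1 := Int.floor_le (t / l)
    have h2 := Int.lt_floor_add_one (t / l)
    rw [le_div_iff₀ hl] at h1
    rw [div_lt_iff₀ hl] at h2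
    constructor <;> linarith
  have hnode : ∀ k : ℤ, c (k * l) = (g ^ k) x := fun k => by
    simp only [hc]
    rw [mul_div_cancel_right₀ _ hl.ne', Int.floor_intCast, sub_self, hγ0]
  have hlow : ∀ t, dist ((g ^ ⌊t / l⌋) x) (c t) = t - ⌊t / l⌋ * l := fun t => by
    simp only [hc]
    rw [IsometryEquiv.dist_eq, ← hγ0, hγ 0 ⟨le_rfl, hl.le⟩ _ ⟨(hfl t).1, (hfl t).2.le⟩,
      abs_of_nonpos (by linarith [(hfl t).1])]
    ring
  have hup : ∀ t, dist (c t) ((g ^ (⌊t / l⌋ + 1)) x) = (⌊t / l⌋ + 1) * l - t := fun t => by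
    simp only [hc]
    rw [zpow_add_one, IsometryEquiv.mul_apply, IsometryEquiv.dist_eq, ← hγ1,
      hγ _ ⟨(hfl t).1, (hfl t).2.le⟩ _ ⟨hl.le, le_rfl⟩, abs_of_nonpos (by linarith [(hfl t).2])]
    ring
  have hlip : ∀ s t, s ≤ t → dist (c s) (c t) ≤ t - s := fun s t hst => by
    have hij : ⌊s / l⌋ ≤ ⌊t / l⌋ := Int.floor_mono (by gcongr)
    rcases hij.eq_or_lt with hij | hij
    · have h1 := hfl s
      have h2 := hfl t
      simp only [hc]
      rw [hij] at h1 ⊢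
      rw [IsometryEquiv.dist_eq, hγ _ ⟨h1.1, h1.2.le⟩ _ ⟨h2.1, h2.2.le⟩,
        abs_of_nonpos (by linarith)]
      linarith
    · have h1 := h.dist_zpow_zpow hx (show ⌊s / l⌋ + 1 ≤ ⌊t / l⌋ by omega)
      push_cast at h1
      have h2 := dist_triangle4 (c s) ((g ^ (⌊s / l⌋ + 1)) x) ((g ^ ⌊t / l⌋) x) (c t)
      rw [hup, h1, hlow] at h2
      linarith
  -- The path is 1-Lipschitz and its nodes at `-N * l` and `N * l` are at the full distance `2 * N *
  -- l`, so no length is lost in between.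
  have hiso : ∀ s t, s ≤ t → dist (c s) (c t) = t - s := fun s t hst => by
    refine le_antisymm (hlip s t hst) ?_
    obtain ⟨N, hN⟩ := exists_nat_ge (max (-s / l) (t / l))
    have h1 := (le_max_left _ _).trans hN
    have h2 := (le_max_right _ _).trans hN
    rw [div_le_iff₀ hl] at h1 h2
    have h3 := h.dist_zpow_zpow hx (show -(N : ℤ) ≤ N by omega)
    rw [← hnode, ← hnode] at h3
    push_cast at h3
    have h4 := hlip (-N * l) s (by linarith)
    have h5 := hlip t (N * l) h2
    have h6 := dist_triangle4 (c (-N * l)) (c s) (c t) (c (N * l))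
    linarith
  refine ⟨c, Isometry.of_dist_eq fun s t => ?_, by simpa using hnode 0, fun t => ?_⟩
  · rcases le_total s t with hst | hst
    · rw [hiso s t hst, Real.dist_eq, abs_of_nonpos (by linarith)]
      ring
    · rw [dist_comm, hiso t s hst, Real.dist_eq, abs_of_nonneg (by linarith)]
  · simp only [hc]
    have : (t + l) / l = t / l + 1 := by field_simp
    rw [this, Int.floor_add_one, add_comm ⌊t / l⌋ 1, zpow_add, zpow_one, IsometryEquiv.mul_apply]
    push_cast
    rw [add_mul, one_mul, add_sub_add_comm]
    congr 3
    ring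

/-- `g` translates the line `c` by `l`. -/
def TranslatesLine (g : X ≃ᵢ X) (c : ℝ → X) (l : ℝ) : Prop := ∀ t, g (c t) = c (t + l)

namespace TranslatesLine

variable {g : X ≃ᵢ X} {c c' : ℝ → X} {l l' : ℝ}

theorem pow (h : TranslatesLine g c l) (n : ℕ) : TranslatesLine (g ^ n) c (n * l) := by
  induction n with
  | zero => intro t; simp
  | succ n ih =>
    intro t
    rw [pow_succ, IsometryEquiv.mul_apply, h, ih]
    push_cast
    congr 1
    ring

theorem inv (h : TranslatesLine g c l) : TranslatesLine g⁻¹ c (-l) := fun t => by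
  have := h (t + -l)
  rw [neg_add_cancel_right] at this
  rw [← this]
  exact g.symm_apply_apply _

theorem zpow (h : TranslatesLine g c l) (n : ℤ) : TranslatesLine (g ^ n) c (n * l) := by
  cases n with
  | ofNat n => simpa using h.pow n
  | negSucc n =>
    rw [zpow_negSucc]
    have := (h.pow (n + 1)).inv
    rw [Int.cast_negSucc]
    convert this using 1
    ring

theorem reverse (h : TranslatesLine g c l) : TranslatesLine g (fun t => c (-t)) (-l) := fun t => by
  simp only
  rw [h, neg_add, neg_neg]

theorem conj (h : TranslatesLine g c l) (k : X ≃ᵢ X) :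
    TranslatesLine (k * g * k⁻¹) (fun t => k (c t)) l := fun t => by
  simp only
  rw [← h, IsometryEquiv.mul_apply, IsometryEquiv.mul_apply]
  congr 2
  exact k.symm_apply_apply _

/-- The displacements of `g ^ n` on the two lines, `n * |l|` and `n * |l'|`, differ by at most a
constant independent of `n`. -/
theorem abs_le (h : TranslatesLine g c l) (h' : TranslatesLine g c' l') (hc : Isometry c)
    (hc' : Isometry c') : |l| ≤ |l'| := by
  by_contra! hlt
  obtain ⟨n, hn⟩ := exists_nat_gt (2 * dist (c 0) (c' 0) / (|l| - |l'|))
  rw [div_lt_iff₀ (by linarith)] at hn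
  have h1 : dist (c 0) ((g ^ n) (c 0)) = n * |l| := by
    rw [h.pow n, hc.dist_eq, Real.dist_eq, zero_add, zero_sub, abs_neg, abs_mul, Nat.abs_cast]
  have h2 : dist (c' 0) ((g ^ n) (c' 0)) = n * |l'| := by
    rw [h'.pow n, hc'.dist_eq, Real.dist_eq, zero_add, zero_sub, abs_neg, abs_mul, Nat.abs_cast]
  have h3 := dist_triangle4 (c 0) (c' 0) ((g ^ n) (c' 0)) ((g ^ n) (c 0))
  rw [IsometryEquiv.dist_eq, dist_comm (c' 0) (c 0), h1, h2] at h3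
  linarith

theorem abs_eq (h : TranslatesLine g c l) (h' : TranslatesLine g c' l') (hc : Isometry c)
    (hc' : Isometry c') : |l| = |l'| :=
  le_antisymm (h.abs_le h' hc hc') (h'.abs_le h hc' hc)

end TranslatesLine

/-- The lines which are translated by `n * l` by some positive power `g ^ n` of `g`. -/
def virtualAxes (g : X ≃ᵢ X) (l : ℝ) : Set (ℝ → X) :=
  {c | Isometry c ∧ ∃ n : ℕ, 0 < n ∧ TranslatesLine (g ^ n) c (n * l)}

theorem IsCAT0.areParallel_of_mem_virtualAxes (h : IsCAT0 X) {g : X ≃ᵢ X} {l : ℝ} (hl : 0 < l)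
    {c c' : ℝ → X} (hc : c ∈ virtualAxes g l) (hc' : c' ∈ virtualAxes g l) :
    AreParallel c c' := by
  obtain ⟨hc, n, hn, hcn⟩ := hc
  obtain ⟨hc', m, hm, hcm⟩ := hc'
  have h1 := hcn.pow m
  have h2 := hcm.pow n
  rw [← pow_mul] at h1 h2
  rw [mul_comm m n] at h2
  have e : (n : ℝ) * (m * l) = m * (n * l) := by ring
  rw [e] at h2
  have hP : 0 < (m : ℝ) * (n * l) := by positivity
  exact h.areParallel_of_periodic hc hc' hP fun s t => by rw [← h1, ← h2, IsometryEquiv.dist_eq]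

/-- An axis of `g` through `x` is also translated by a power of `g₀`, by the same length as on `c₀`.
Only the direction can differ, and reversing the line repairs that. -/
theorem IsCAT0.exists_virtualAxis (h : IsCAT0 X) {g g₀ : X ≃ᵢ X} (hg : IsHyperbolicIsom g)
    {c₀ : ℝ → X} {l : ℝ} (hc₀ : Isometry c₀) (hgc₀ : TranslatesLine g₀ c₀ l) (hl : 0 < l)
    (hcp : HaveCommonPower g g₀) {x : X} (hx : x ∈ minSet g) :
    ∃ c ∈ virtualAxes g₀ l, c 0 = x := by
  obtain ⟨c, hc, hc0, hgc⟩ := h.exists_axis hg hx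
  replace hgc : TranslatesLine g c (translationLength g) := hgc
  have : ∃ (a : ℤ) (b : ℕ), 0 < b ∧ g ^ a = g₀ ^ b := by
    obtain ⟨a, b, -, hb, e⟩ := hcp
    rcases hb.lt_or_gt with hb | hb
    · refine ⟨-a, b.natAbs, by omega, ?_⟩
      rw [← zpow_natCast, Int.ofNat_natAbs_of_nonpos hb.le, zpow_neg, zpow_neg, e]
    · refine ⟨a, b.natAbs, by omega, ?_⟩
      rw [← zpow_natCast, Int.natAbs_of_nonneg hb.le, e]
  obtain ⟨a, b, hb, e⟩ := this
  have h1 := hgc.zpow a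
  rw [e] at h1
  have h2 := h1.abs_eq (hgc₀.pow b) hc hc₀
  rw [abs_of_nonneg (show 0 ≤ b * l by positivity)] at h2
  rcases abs_choice (a * translationLength g) with h3 | h3
  · exact ⟨c, ⟨hc, b, hb, by rwa [← h2, h3]⟩, hc0⟩
  · exact ⟨fun t => c (-t), ⟨hc.comp (Isometry.of_dist_eq fun s t => dist_neg_neg s t), b, hb,
      by rw [← h2, h3]; exact h1.reverse⟩, by simpa using hc0⟩

/-! ### Minimum sets: local finiteness, connectedness, conjugation -/

theorem isClosed_minSet (g : X ≃ᵢ X) : IsClosed (minSet g) :=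
  isClosed_eq (continuous_id.dist g.continuous) continuous_const

theorem IsDiscreteGroup.locallyFinite_minSet {Γ : Subgroup (X ≃ᵢ X)} (hd : IsDiscreteGroup Γ)
    (L : ℝ) {S : Set (X ≃ᵢ X)} (hS : ∀ g ∈ S, g ∈ Γ ∧ translationLength g ≤ L) :
    LocallyFinite fun g : S => minSet (g : X ≃ᵢ X) := by
  intro x
  refine ⟨ball x 1, ball_mem_nhds x one_pos, ?_⟩
  refine Finite.of_finite_image ((hd x (max 0 (L + 2)) (le_max_left _ _)).subset ?_)
    Subtype.val_injective.injOn
  rintro _ ⟨g, ⟨y, hy, hyx⟩, rfl⟩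
  refine ⟨(hS g g.2).1, lt_max_of_lt_right ?_⟩
  have h1 : dist y (g.1 y) ≤ L := (show _ = _ from hy).trans_le (hS g g.2).2
  have h2 := dist_triangle4 x y (g.1 y) (g.1 x)
  rw [IsometryEquiv.dist_eq, dist_comm x y] at h2
  rw [mem_ball] at hyx
  linarith

theorem haveCommonPower_of_cover [PreconnectedSpace X] {Γ : Subgroup (X ≃ᵢ X)}
    (hd : IsDiscreteGroup Γ) (L : ℝ) {S : Set (X ≃ᵢ X)}
    (hS : ∀ g ∈ S, g ∈ Γ ∧ translationLength g ≤ L ∧ (minSet g).Nonempty)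
    (hcover : (⋃ g ∈ S, minSet g) = univ)
    (hcp : ∀ g ∈ S, ∀ h ∈ S, (minSet g ∩ minSet h).Nonempty → HaveCommonPower g h) :
    ∀ g ∈ S, ∀ h ∈ S, HaveCommonPower g h := by
  intro g hg
  have hcl : ∀ p : (X ≃ᵢ X) → Prop, IsClosed (⋃ k : {k | k ∈ S ∧ p k}, minSet k.1) := fun p =>
    (hd.locallyFinite_minSet L fun k hk => ⟨(hS k hk.1).1, (hS k hk.1).2.1⟩).isClosed_iUnion
      fun k => isClosed_minSet _
  set U := ⋃ k : {k | k ∈ S ∧ HaveCommonPower g k}, minSet k.1 with hU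
  set V := ⋃ k : {k | k ∈ S ∧ ¬ HaveCommonPower g k}, minSet k.1 with hV
  -- A point in both sets would lie in two meeting minimum sets, whose elements share a power,
  -- contradicting transitivity. Local finiteness makes both sets closed, so `U` is clopen.
  have hUV : Uᶜ = V := by
    have hmem : ∀ (p : (X ≃ᵢ X) → Prop) (x : X),
        (x ∈ ⋃ k : {k | k ∈ S ∧ p k}, minSet k.1) ↔ ∃ k, (k ∈ S ∧ p k) ∧ x ∈ minSet k :=
      fun p x => by simp only [mem_iUnion, Subtype.exists, mem_ofPred_eq, exists_prop]
    ext x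
    have hx : x ∈ ⋃ k ∈ S, minSet k := hcover ▸ mem_univ x
    simp only [mem_iUnion, exists_prop] at hx
    obtain ⟨k, hk, hxk⟩ := hx
    rw [mem_compl_iff, hU, hV, hmem, hmem]
    constructor
    · intro H
      exact ⟨k, ⟨hk, fun hgk => H ⟨k, ⟨hk, hgk⟩, hxk⟩⟩, hxk⟩
    · rintro ⟨k', ⟨hk', hgk'⟩, hxk'⟩ ⟨j, ⟨hj, hgj⟩, hxj⟩
      exact hgk' (hgj.trans (hcp j hj k' hk' ⟨x, hxj, hxk'⟩))
  have hclopen : IsClopen U := ⟨hcl _, by rw [← isClosed_compl_iff, hUV]; exact hcl _⟩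
  have huniv : U = univ := hclopen.eq_univ <| by
    obtain ⟨x, hx⟩ := (hS g hg).2.2
    exact ⟨x, mem_iUnion.2 ⟨⟨g, hg, 1, 1, one_ne_zero, one_ne_zero, rfl⟩, hx⟩⟩
  intro h hh
  obtain ⟨x, hx⟩ := (hS h hh).2.2
  obtain ⟨⟨k, hk, hgk⟩, hxk⟩ := mem_iUnion.1 (huniv ▸ mem_univ x : x ∈ U)
  exact hgk.trans (hcp k hk h hh ⟨x, hxk, hx⟩)

theorem translationLength_conj (g k : X ≃ᵢ X) :
    translationLength (k * g * k⁻¹) = translationLength g := by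
  unfold translationLength
  refine (k.toEquiv.iInf_congr fun x => ?_).symm
  change dist (k x) (k (g (k.symm (k x)))) = dist x (g x)
  rw [k.dist_eq, k.symm_apply_apply]

theorem minSet_conj (g k : X ≃ᵢ X) : minSet (k * g * k⁻¹) = k '' minSet g := by
  ext x
  rw [show k '' minSet g = k.symm ⁻¹' minSet g from k.toEquiv.image_eq_preimage_symm _,
    mem_preimage]
  simp only [minSet, mem_ofPred_eq, translationLength_conj]
  change dist x (k (g (k.symm x))) = _ ↔ _
  rw [← k.symm.dist_eq, k.symm_apply_apply]

theorem conj_mem_shortHyperbolics {Γ : Subgroup (X ≃ᵢ X)} {L : ℝ} {g k : X ≃ᵢ X}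
    (hg : g ∈ shortHyperbolics Γ L) (hk : k ∈ Γ) : k * g * k⁻¹ ∈ shortHyperbolics Γ L := by
  obtain ⟨h1, ⟨h2, h3⟩, h4, h5⟩ := hg
  refine ⟨Γ.mul_mem (Γ.mul_mem hk h1) (Γ.inv_mem hk), ⟨?_, ?_⟩, ?_, ?_⟩
  · rw [minSet_conj]; exact h2.image _
  · rwa [translationLength_conj]
  · rwa [translationLength_conj]
  · rw [minSet_conj, ← IsometryEquiv.coe_toHomeomorph, ← Homeomorph.image_interior]
    exact h5.image _

end Axes

/-! ### Projections to convex sets and minimality of the action -/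

section InvariantConvexSets

variable {X : Type u} [MetricSpace X]

/-- The nearest point projection onto a closed convex subset of a complete CAT(0) space. -/
theorem IsCAT0.exists_nearest_point [CompleteSpace X] (h : IsCAT0 X) {F : Set X}
    (hF : IsClosed F) (hne : F.Nonempty)
    (hconv : ∀ x ∈ F, ∀ y ∈ F, ∀ m, IsMetricMidpoint m x y → m ∈ F) (x : X) :
    ∃ p ∈ F, ∀ q ∈ F, dist x p ≤ dist x q := by
  set D := infDist x F with hD
  have hD0 : 0 ≤ D := infDist_nonneg
  have hle : ∀ q ∈ F, D ≤ dist x q := fun q hq => infDist_le_dist_of_mem hq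
  have hex : ∀ n : ℕ, ∃ q ∈ F, dist x q < D + 1 / ((n : ℝ) + 1) := fun n =>
    (infDist_lt_iff hne).1 (by linarith [show (0 : ℝ) < 1 / ((n : ℝ) + 1) by positivity])
  choose q hq hqD using hex
  have hlim : Tendsto (fun n : ℕ => 1 / ((n : ℝ) + 1)) atTop (𝓝 0) :=
    tendsto_one_div_add_atTop_nhds_zero_nat
  have hcauchy : CauchySeq q := by
    refine cauchySeq_of_le_tendsto_0
      (fun n : ℕ => Real.sqrt (8 * D * (1 / ((n : ℝ) + 1)) + 4 * (1 / ((n : ℝ) + 1)) ^ 2)) ?_ ?_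
    · intro n m N hn hm
      apply Real.le_sqrt_of_sq_le
      obtain ⟨p, hp⟩ := h.exists_midpoint (q n) (q m)
      have h1 := h.cn x hp
      have h2 := hle p (hconv _ (hq n) _ (hq m) p hp)
      have h3 : ∀ k, N ≤ k → dist x (q k) ^ 2 ≤ (D + 1 / ((N : ℝ) + 1)) ^ 2 := fun k hk => by
        have : 1 / ((k : ℝ) + 1) ≤ 1 / ((N : ℝ) + 1) := by gcongr
        gcongr
        linarith [hqD k]
      have h4 : D ^ 2 ≤ dist x p ^ 2 := by gcongr
      nlinarith [h3 n hn, h3 m hm]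
    · have : Tendsto (fun n : ℕ =>
          Real.sqrt (8 * D * (1 / ((n : ℝ) + 1)) + 4 * (1 / ((n : ℝ) + 1)) ^ 2)) atTop
          (𝓝 (Real.sqrt (8 * D * 0 + 4 * 0 ^ 2))) :=
        ((hlim.const_mul _).add ((hlim.pow 2).const_mul _)).sqrt
      simpa using this
  obtain ⟨p, hp⟩ := cauchySeq_tendsto_of_complete hcauchy
  refine ⟨p, hF.mem_of_tendsto hp (Eventually.of_forall hq), fun r hr => le_trans ?_ (hle r hr)⟩
  have h1 : Tendsto (fun n : ℕ => D + 1 / ((n : ℝ) + 1)) atTop (𝓝 (D + 0)) := hlim.const_add D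
  rw [add_zero] at h1
  exact le_of_tendsto_of_tendsto' (tendsto_const_nhds.dist hp) h1 fun n => (hqD n).le

/-- A weak form of the obtuse angle property of the nearest point projection. -/
theorem IsCAT0.dist_sq_add_le_of_nearest (h : IsCAT0 X) {F : Set X}
    (hconv : ∀ x ∈ F, ∀ y ∈ F, ∀ m, IsMetricMidpoint m x y → m ∈ F) {x p : X} (hp : p ∈ F)
    (hmin : ∀ q ∈ F, dist x p ≤ dist x q) (q : X) (hq : q ∈ F) :
    dist x p ^ 2 + 3 / 4 * dist p q ^ 2 ≤ dist x q ^ 2 := by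
  have step : ∀ a : ℝ, (∀ q ∈ F, dist x p ^ 2 + a * dist p q ^ 2 ≤ dist x q ^ 2) →
      ∀ q ∈ F, dist x p ^ 2 + (1 / 2 + a / 2) * dist p q ^ 2 ≤ dist x q ^ 2 := by
    intro a ha q hq
    obtain ⟨m, hm⟩ := h.exists_midpoint p q
    have h1 := ha m (hconv _ hp _ hq m hm)
    have h2 := h.cn x hm
    rw [hm.1] at h1
    linarith
  have h0 : ∀ q ∈ F, dist x p ^ 2 + 0 * dist p q ^ 2 ≤ dist x q ^ 2 := fun q hq => by
    have : dist x p ^ 2 ≤ dist x q ^ 2 := by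
      gcongr
      exact hmin q hq
    linarith
  -- Two rounds take the coefficient from `0` through `1 / 2` to `3 / 4`. The quadrilateral estimate
  -- for thickness below needs a value strictly above `1 / 2`.
  linarith [step _ (step _ h0) q hq]

theorem IsDiscreteGroup.exists_gap {Γ : Subgroup (X ≃ᵢ X)} (hd : IsDiscreteGroup Γ) (x : X) :
    ∃ ε > 0, ∀ g ∈ Γ, g x ≠ x → ε ≤ dist x (g x) := by
  have hfin : {g : X ≃ᵢ X | (g ∈ Γ ∧ dist x (g x) < 1) ∧ g x ≠ x}.Finite :=
    (hd x 1 zero_le_one).subset fun g hg => hg.1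
  have hfin' := (hfin.image fun g => dist x (g x)).insert 1
  obtain ⟨e, he, hmin⟩ := Set.exists_min_image _ id hfin' (insert_nonempty _ _)
  refine ⟨e, ?_, fun g hg hgx => ?_⟩
  · rcases he with rfl | ⟨g, hg, rfl⟩
    · exact one_pos
    · exact dist_pos.2 fun h => hg.2 h.symm
  · by_cases h1 : dist x (g x) < 1
    · exact hmin _ (Or.inr ⟨g, ⟨⟨hg, h1⟩, hgx⟩, rfl⟩)
    · exact (hmin 1 (Or.inl rfl)).trans (not_lt.1 h1)

theorem isEllipticIsom_of_fixed {g : X ≃ᵢ X} {x : X} (hx : g x = x) : IsEllipticIsom g := by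
  have h0 : translationLength g = 0 :=
    le_antisymm ((translationLength_le g x).trans (by rw [hx, dist_self]))
      (Real.iInf_nonneg fun _ => dist_nonneg)
  exact ⟨⟨x, by rw [minSet, mem_ofPred_eq, h0, hx, dist_self]⟩, h0⟩

theorem interior_biUnion_eq_empty {ι Z : Type*} [TopologicalSpace Z] {s : Set ι}
    (hs : s.Finite) {f : ι → Set Z} (hc : ∀ i ∈ s, IsClosed (f i))
    (he : ∀ i ∈ s, interior (f i) = ∅) : interior (⋃ i ∈ s, f i) = ∅ := by
  induction s, hs using Set.Finite.induction_on with
  | empty => simp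
  | @insert a s _ hs ih =>
    rw [biUnion_insert, interior_union_isClosed_of_interior_empty (hc a (mem_insert _ _))]
    · exact he a (mem_insert _ _)
    · exact ih (fun i hi => hc i (mem_insert_of_mem _ hi)) fun i hi => he i (mem_insert_of_mem _ hi)

/-- Points with trivial stabilizer are dense for discrete slim groups. -/
theorem IsSlimGroup.exists_free_point {Γ : Subgroup (X ≃ᵢ X)} (hslim : IsSlimGroup Γ)
    (hd : IsDiscreteGroup Γ) {U : Set X} (hU : IsOpen U) (hne : U.Nonempty) :
    ∃ x ∈ U, ∀ g ∈ Γ, g x = x → g = 1 := by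
  obtain ⟨x, hx⟩ := hne
  set S : Set (X ≃ᵢ X) := {g | (g ∈ Γ ∧ dist x (g x) < 2) ∧ g ≠ 1 ∧ ∃ y, g y = y} with hS
  have hfin : S.Finite := (hd x 2 zero_le_two).subset fun g hg => hg.1
  have hint : interior (⋃ g ∈ S, {y | g y = y}) = ∅ :=
    interior_biUnion_eq_empty hfin (fun g _ => isClosed_eq g.continuous continuous_id)
      fun g hg => by
        obtain ⟨y, hy⟩ := hg.2.2
        exact hslim g hg.1.1 hg.2.1 (isEllipticIsom_of_fixed hy)
  by_contra! hcon
  have hsub : U ∩ ball x 1 ⊆ ⋃ g ∈ S, {y | g y = y} := by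
    rintro y ⟨hyU, hyx⟩
    obtain ⟨g, hg, hgy, hg1⟩ := hcon y hyU
    refine mem_biUnion (x := g) ⟨⟨hg, ?_⟩, hg1, y, hgy⟩ hgy
    have h2 := dist_triangle4 x y (g y) (g x)
    rw [IsometryEquiv.dist_eq, hgy, dist_self, dist_comm x y] at h2
    rw [mem_ball] at hyx
    linarith
  have := interior_maximal hsub (hU.inter isOpen_ball) ⟨hx, mem_ball_self one_pos⟩
  rw [hint] at this
  exact this

/-- A discrete, slim, almost-cocompact group acts minimally: it has no proper closed convex
invariant subset. -/
theorem eq_univ_of_invariant_convex [CompleteSpace X] (hcat : IsCAT0 X)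
    (hgc : IsGeodesicallyComplete X) {Γ : Subgroup (X ≃ᵢ X)} (hdisc : IsDiscreteGroup Γ)
    (hslim : IsSlimGroup Γ) (hac : IsAlmostCocompact Γ) {F : Set X} (hF : IsClosed F)
    (hne : F.Nonempty) (hconv : ∀ x ∈ F, ∀ y ∈ F, ∀ m, IsMetricMidpoint m x y → m ∈ F)
    (hinv : ∀ g ∈ Γ, ∀ x ∈ F, g x ∈ F) : F = univ := by
  by_contra hFu
  obtain ⟨x, hxF, hfree⟩ := hslim.exists_free_point hdisc hF.isOpen_compl
    (nonempty_compl.2 hFu)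
  obtain ⟨p, hp, hmin⟩ := hcat.exists_nearest_point hF hne hconv x
  have hpx : 0 < dist p x := dist_pos.2 fun e => hxF (e ▸ hp)
  obtain ⟨c₀, hc₀, hc₀0, hc₀1⟩ := hcat.exists_geodesic p x
  obtain ⟨c, hc, hcc⟩ := hgc 0 (dist p x) c₀ hpx hc₀
  set T := dist p x with hT
  have hc0 : c 0 = p := by rw [hcc ⟨le_rfl, hpx.le⟩, hc₀0]
  have hcT : c T = x := by rw [hcc ⟨hpx.le, le_rfl⟩, hc₀1]
  have hmid : ∀ t, IsMetricMidpoint (c t) p (c (2 * t)) := fun t => by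
    have := hc.isMetricMidpoint t t
    rwa [sub_self, hc0, ← two_mul] at this
  -- Beyond `x`, the extended geodesic keeps receding from `F`, with nearest point `p`: contraction
  -- by one half towards `p` maps `F` into itself and carries each stage to the previous one.
  have hproj : ∀ n : ℕ, ∀ q ∈ F,
      (2 ^ n * T) ^ 2 + 3 / 4 * dist p q ^ 2 ≤ dist (c (2 ^ n * T)) q ^ 2 := by
    intro n
    induction n with
    | zero =>
      intro q hq
      have := hcat.dist_sq_add_le_of_nearest hconv hp hmin q hq
      rwa [dist_comm x p, ← hT, ← hcT, ← one_mul T, ← pow_zero (2 : ℝ)] at this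
    | succ n ih =>
      intro q hq
      obtain ⟨m, hm⟩ := hcat.exists_midpoint p q
      have h1 := ih m (hconv _ hp _ hq m hm)
      have h2 := hcat.dist_midpoints_le_half (hmid (2 ^ n * T)) hm
      have h3 : dist (c (2 ^ n * T)) m ^ 2 ≤ (dist (c (2 * (2 ^ n * T))) q / 2) ^ 2 := by gcongr
      rw [hm.1] at h1
      rw [pow_succ' (2 : ℝ) n, mul_assoc]
      nlinarith
  obtain ⟨ε, hε, hεx⟩ := hdisc.exists_gap x
  obtain ⟨δ, hδ, hδp⟩ := hdisc.exists_gap p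
  have hthick : ∀ n : ℕ, c (2 ^ n * T) ∈ thickSet Γ (min ε (δ / 2)) := by
    intro n
    change ENNReal.ofReal (min ε (δ / 2)) ≤ systoleAt Γ _
    refine le_iInf fun g => le_iInf fun hg => le_iInf fun hg1 => ?_
    rw [edist_dist]
    refine ENNReal.ofReal_le_ofReal ?_
    -- If `g` fixes `p`, its displacement does not decrease along the dyadic points, starting from
    -- at least `ε` at the free point `x`. Otherwise the quadrilateral on `p`, `g p` and the two ray
    -- points bounds it below by a fraction of the displacement of `p`.
    by_cases hgp : g p = p
    · refine (min_le_left _ _).trans ((hεx g hg fun e => hg1 (hfree g hg e)).trans ?_)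
      induction n with
      | zero => rw [pow_zero, one_mul, hcT]
      | succ n ih =>
        have h1 := (hmid (2 ^ n * T)).map g
        rw [hgp] at h1
        have h2 := hcat.dist_midpoints_le_half (hmid (2 ^ n * T)) h1
        rw [pow_succ' (2 : ℝ) n, mul_assoc]
        linarith [dist_nonneg (x := c (2 * (2 ^ n * T))) (y := g (c (2 * (2 ^ n * T))))]
    · refine (min_le_right _ _).trans ?_
      have h1 := hproj n (g p) (hinv g hg p hp)
      have h2 := hproj n (g⁻¹ p) (hinv _ (Γ.inv_mem hg) p hp)
      have e : ∀ y, dist y (g⁻¹ p) = dist (g y) p := fun y => by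
        rw [← g.dist_eq y]
        congr 1
        exact g.apply_symm_apply p
      rw [e, e, dist_comm (g p) p] at h2
      have h3 := hcat.quadrilateral (c (2 ^ n * T)) (g (c (2 ^ n * T))) (g p) p
      have h4 : dist p (c (2 ^ n * T)) = 2 ^ n * T := by
        rw [← hc0, hc.dist_eq, Real.dist_eq, zero_sub, abs_neg, abs_of_nonneg (by positivity)]
      rw [g.dist_eq, h4, dist_comm (c _) p, h4, dist_comm (g p) p] at h3
      have h5 := hδp g hg hgp
      have h6 : δ ^ 2 ≤ dist p (g p) ^ 2 := by gcongr
      refine (abs_le_of_sq_le_sq' ?_ dist_nonneg).2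
      nlinarith
  -- The thick ray would stay within bounded distance of the orbit of `p`, which lies in `F`; but
  -- its distance to `F` is unbounded.
  obtain ⟨K, hK, hKt⟩ := hac (min ε (δ / 2)) (by positivity)
  obtain ⟨R, hR⟩ := hK.isBounded.subset_closedBall p
  obtain ⟨n, hn⟩ := pow_unbounded_of_one_lt (R / T) one_lt_two
  rw [div_lt_iff₀ hpx] at hn
  have h1 := hthick n
  rw [← hKt] at h1
  simp only [mem_iUnion, exists_prop] at h1
  obtain ⟨g, hg, k, hk, hgk⟩ := h1
  have h2 := hproj n (g p) (hinv g hg p hp)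
  rw [← hgk, g.dist_eq] at h2
  have h3 := hR hk
  rw [mem_closedBall] at h3
  have h4 : 0 < 2 ^ n * T := by positivity
  nlinarith [sq_nonneg (dist p (g p)), dist_nonneg (x := k) (y := p)]

end InvariantConvexSets

/-! ### Normalized powers, centralizers and characters -/

/-- If every element of a finitely generated group normalizes a power of `g` up to inversion,
then a single power works for all elements. -/
theorem Subgroup.FG.exists_pow_conj {G : Type*} [Group G] {Γ : Subgroup G} (hfg : Γ.FG) {g : G}
    (h : ∀ γ ∈ Γ, ∃ a : ℕ, 0 < a ∧ (γ * g ^ a * γ⁻¹ = g ^ a ∨ γ * g ^ a * γ⁻¹ = (g ^ a)⁻¹)) :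
    ∃ N : ℕ, 0 < N ∧ ∀ γ ∈ Γ, γ * g ^ N * γ⁻¹ = g ^ N ∨ γ * g ^ N * γ⁻¹ = (g ^ N)⁻¹ := by
  obtain ⟨S, hS⟩ := hfg
  have h' : ∀ γ : G, ∃ a : ℕ, 0 < a ∧
      (γ ∈ S → (γ * g ^ a * γ⁻¹ = g ^ a ∨ γ * g ^ a * γ⁻¹ = (g ^ a)⁻¹)) := fun γ => by
    by_cases hγ : γ ∈ S
    · obtain ⟨a, ha, H⟩ := h γ (hS ▸ Subgroup.subset_closure hγ)
      exact ⟨a, ha, fun _ => H⟩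
    · exact ⟨1, one_pos, fun H => (hγ H).elim⟩
  choose a ha haS using h'
  -- The condition passes to multiples of the exponent, so the product over the generators serves
  -- all of them.
  refine ⟨∏ γ ∈ S, a γ, Finset.prod_pos fun γ _ => ha γ, fun γ hγ => ?_⟩
  set N := ∏ γ ∈ S, a γ with hN
  rw [← hS] at hγ
  induction hγ using Subgroup.closure_induction with
  | mem x hx =>
    obtain ⟨k, hk⟩ : a x ∣ N := Finset.dvd_prod_of_mem a hx
    rw [hk, pow_mul, ← conj_pow, ← inv_pow]
    exact (haS x hx).imp (fun e => by rw [e]) fun e => by rw [e]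
  | one => simp
  | mul x y _ _ hx hy =>
    have e : x * y * g ^ N * (x * y)⁻¹ = x * (y * g ^ N * y⁻¹) * x⁻¹ := by group
    rw [e]
    rcases hy with hy | hy
    · rwa [hy]
    · rw [hy, ← conj_inv]
      rcases hx with hx | hx <;> simp [hx]
  | inv x _ hx =>
    rcases hx with hx | hx
    · left
      nth_rw 1 [← hx]
      group
    · right
      have : (x * g ^ N * x⁻¹)⁻¹ = g ^ N := by rw [hx, inv_inv]
      nth_rw 1 [← this]
      group

/-- The centralizer of `w` has finite index if `w` has finitely many conjugates. -/
theorem relIndex_centralizer_ne_zero {G : Type*} [Group G] {Γ : Subgroup G} {w : G} {T : Set G}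
    (hT : T.Finite) (h : ∀ γ ∈ Γ, γ * w * γ⁻¹ ∈ T) :
    (Γ ⊓ Subgroup.centralizer {w}).relIndex Γ ≠ 0 := by
  have : Finite T := hT
  let f : Γ ⧸ (Γ ⊓ Subgroup.centralizer {w}).subgroupOf Γ → T := fun q =>
    ⟨(q.out : G) * w * (q.out : G)⁻¹, h _ q.out.2⟩
  have hf : Function.Injective f := by
    intro p q hpq
    have e : (p.out : G) * w * (p.out : G)⁻¹ = (q.out : G) * w * (q.out : G)⁻¹ :=
      congrArg Subtype.val hpq
    rw [← QuotientGroup.out_eq' p, ← QuotientGroup.out_eq' q, QuotientGroup.eq,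
      Subgroup.mem_subgroupOf]
    refine ⟨(p.out⁻¹ * q.out).2, Subgroup.mem_centralizer_singleton_iff.2 ?_⟩
    push_cast
    generalize (p.out : G) = x at e ⊢
    generalize (q.out : G) = y at e ⊢
    calc x⁻¹ * y * w = x⁻¹ * (y * w * y⁻¹) * y := by group
      _ = w * (x⁻¹ * y) := by rw [← e]; group
  have := Finite.of_injective f hf
  exact (Subgroup.finiteIndex_of_finite_quotient).index_ne_zero

/-- A finitely generated group with a real character not vanishing at `z` has a finite index
subgroup with an integral character taking the value `1` at `z`. -/
theorem exists_finite_index_character {K : Type*} [Group K] [Group.FG K]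
    (τ : K →* Multiplicative ℝ) {z : K} (hz : τ z ≠ 1) :
    ∃ H : Subgroup K, H.index ≠ 0 ∧ ∃ (hzH : z ∈ H) (χ : H →* Multiplicative ℤ),
      χ ⟨z, hzH⟩ = Multiplicative.ofAdd 1 := by
  let t : Additive K →+ ℝ := MonoidHom.toAdditiveLeft τ
  have : Module.Finite ℤ t.range := by
    have : AddGroup.FG t.range := AddGroup.fg_range t
    exact Module.Finite.iff_addGroup_fg.2 this
  have : Module.Free ℤ t.range := inferInstance
  -- The image of the character is finitely generated and torsion-free, hence free over `ℤ`. Some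
  -- coordinate takes a nonzero value `m` at `z`; it is restricted to where `m` divides it and then
  -- divided by `m`.
  let b := Module.Free.chooseBasis ℤ t.range
  have hz0 : t.rangeRestrict (Additive.ofMul z) ≠ 0 := fun e => hz (congrArg Subtype.val e)
  obtain ⟨i, hi⟩ : ∃ i, b.coord i (t.rangeRestrict (Additive.ofMul z)) ≠ 0 := by
    by_contra! hcon
    exact hz0 (b.ext_elem fun i => by simpa using hcon i)
  let ψ : Additive K →+ ℤ := (b.coord i).toAddMonoidHom.comp t.rangeRestrict
  set m := ψ (Additive.ofMul z) with hm
  have hm0 : m ≠ 0 := hi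
  let Ψ : K →* Multiplicative ℤ := AddMonoidHom.toMultiplicativeRight ψ
  have hΨz : (Ψ z).toAdd = m := rfl
  let H : Subgroup K := (AddSubgroup.zmultiples m).toSubgroup.comap Ψ
  have hH : ∀ x, x ∈ H ↔ m ∣ (Ψ x).toAdd := fun x => Int.mem_zmultiples_iff
  have hzH : z ∈ H := (hH z).2 (by rw [hΨz])
  have hidx : (AddSubgroup.zmultiples m).toSubgroup.index ≠ 0 := by
    rw [AddSubgroup.index_toSubgroup, Int.index_zmultiples]
    exact Int.natAbs_ne_zero.2 hm0
  let χ : H →* Multiplicative ℤ :=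
    { toFun := fun x => Multiplicative.ofAdd ((Ψ x).toAdd / m)
      map_one' := by simp
      map_mul' := fun x y => by
        rw [← ofAdd_add, ← Int.add_ediv_of_dvd_left ((hH x).1 x.2), Subgroup.coe_mul, map_mul,
          toAdd_mul] }
  refine ⟨H, ?_, hzH, χ, ?_⟩
  · rw [Subgroup.index_comap]
    exact fun e => hidx (Subgroup.index_eq_zero_of_relIndex_eq_zero e)
  · change Multiplicative.ofAdd ((Ψ z).toAdd / m) = _
    rw [hΨz, Int.ediv_self hm0]

/-! ### Product actions and virtual splitting -/

section ProductActions

variable {X Y : Type u} [MetricSpace X] [MetricSpace Y]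

/-- Isometries acting on `Y × ℝ` by maps of `Y` and translations of `ℝ` do so through group
homomorphisms. -/
theorem exists_product_action [Nonempty Y] (φ : X ≃ᵢ WithLp 2 (Y × ℝ)) (K : Subgroup (X ≃ᵢ X))
    (hK : ∀ γ ∈ K, ∃ (A : Y → Y) (b : ℝ), ∀ x,
      φ (γ x) = WithLp.toLp 2 (A (φ x).fst, (φ x).snd + b)) :
    ∃ (α : K →* (Y ≃ᵢ Y)) (τ : K →* Multiplicative ℝ), ∀ (γ : K) (x : X),
      φ ((γ : X ≃ᵢ X) x) = WithLp.toLp 2 (α γ (φ x).fst, (φ x).snd + (τ γ).toAdd) := by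
  have hK' : ∀ γ : K, ∃ (A : Y → Y) (b : ℝ), ∀ x,
      φ ((γ : X ≃ᵢ X) x) = WithLp.toLp 2 (A (φ x).fst, (φ x).snd + b) := fun γ => hK γ γ.2
  choose A b hAb using hK'
  let s : Y → X := fun y => φ.symm (WithLp.toLp 2 (y, 0))
  have hs : ∀ y, φ (s y) = WithLp.toLp 2 (y, 0) := fun y => φ.apply_symm_apply _
  have hA : ∀ (γ : K) y, (φ ((γ : X ≃ᵢ X) (s y))).fst = A γ y := fun γ y => by rw [hAb, hs]; rfl
  have hb : ∀ (γ : K) y, (φ ((γ : X ≃ᵢ X) (s y))).snd = b γ := fun γ y => by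
    rw [hAb, hs]; exact zero_add _
  have hA1 : ∀ y, A 1 y = y := fun y => by
    rw [← hA]
    change (φ (s y)).fst = y
    rw [hs]; rfl
  have hb1 : b 1 = 0 := by
    obtain ⟨y⟩ := ‹Nonempty Y›
    rw [← hb 1 y]
    change (φ (s y)).snd = 0
    rw [hs]; rfl
  have hmul : ∀ γ γ' y, A (γ * γ') y = A γ (A γ' y) ∧ b (γ * γ') = b γ + b γ' := by
    intro γ γ' y
    have h1 : φ (((γ * γ' : K) : X ≃ᵢ X) (s y)) =
        WithLp.toLp 2 (A γ (A γ' y), 0 + b γ' + b γ) := by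
      rw [Subgroup.coe_mul, IsometryEquiv.mul_apply, hAb, hAb, hs]
      rfl
    constructor
    · rw [← hA, h1]; rfl
    · rw [← hb _ y, h1]
      change 0 + b γ' + b γ = _
      ring
  have hiso : ∀ γ, Isometry (A γ) := fun γ => Isometry.of_dist_eq fun y y' => by
    have h1 : dist (φ ((γ : X ≃ᵢ X) (s y))) (φ ((γ : X ≃ᵢ X) (s y'))) = dist (φ (s y)) (φ (s y')) := by
      rw [φ.dist_eq, φ.dist_eq, IsometryEquiv.dist_eq]
    rw [WithLp.prod_dist_eq_sqrt, WithLp.prod_dist_eq_sqrt, hA, hA, hb, hb, hs, hs] at h1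
    simpa [Real.sqrt_sq dist_nonneg] using h1
  let αe : K → (Y ≃ᵢ Y) := fun γ =>
    ⟨⟨A γ, A γ⁻¹, fun y => by rw [← (hmul _ _ _).1, inv_mul_cancel, hA1],
      fun y => by rw [← (hmul _ _ _).1, mul_inv_cancel, hA1]⟩, hiso γ⟩
  let α : K →* (Y ≃ᵢ Y) :=
    { toFun := αe
      map_one' := IsometryEquiv.ext fun y => hA1 y
      map_mul' := fun γ γ' => IsometryEquiv.ext fun y => (hmul γ γ' y).1 }
  let τ : K →* Multiplicative ℝ :=
    { toFun := fun γ => Multiplicative.ofAdd (b γ)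
      map_one' := by rw [hb1]; rfl
      map_mul' := fun γ γ' => by
        obtain ⟨y⟩ := ‹Nonempty Y›
        rw [(hmul γ γ' y).2]; rfl }
  exact ⟨α, τ, hAb⟩

/-- The group of translations of `ℝ` by the integral multiples of `L`. -/
noncomputable def integralTranslations (L : ℝ) : Multiplicative ℤ →* (ℝ ≃ᵢ ℝ) where
  toFun n := IsometryEquiv.addRight (n.toAdd * L)
  map_one' := IsometryEquiv.ext fun x => by simp
  map_mul' m n := IsometryEquiv.ext fun x => by
    simp only [IsometryEquiv.mul_apply, IsometryEquiv.addRight_apply, toAdd_mul]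
    push_cast
    ring

theorem integralTranslations_apply (L : ℝ) (n : Multiplicative ℤ) (x : ℝ) :
    integralTranslations L n x = x + n.toAdd * L := rfl

theorem integralTranslations_injective {L : ℝ} (hL : 0 < L) :
    Function.Injective (integralTranslations L) := fun m n h => by
  have := congrArg (fun f : ℝ ≃ᵢ ℝ => f 0) h
  simp only [integralTranslations_apply, zero_add] at this
  have := mul_right_cancel₀ hL.ne' this
  exact Multiplicative.toAdd.injective (by exact_mod_cast this)

theorem isDiscreteGroup_integralTranslations {L : ℝ} (hL : 0 < L) :
    IsDiscreteGroup (integralTranslations L).range := by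
  intro x η _
  refine ((finite_Icc (-⌈η / L⌉) ⌈η / L⌉).image
    fun n => integralTranslations L (Multiplicative.ofAdd n)).subset ?_
  rintro _ ⟨⟨n, rfl⟩, h⟩
  refine ⟨n.toAdd, ?_, rfl⟩
  rw [integralTranslations_apply, Real.dist_eq, sub_add_cancel_left, abs_neg, abs_mul,
    abs_of_pos hL, ← lt_div_iff₀ hL] at h
  have h1 : |n.toAdd| ≤ ⌈η / L⌉ := by
    have := h.le.trans (Int.le_ceil _)
    exact_mod_cast this
  exact abs_le.1 h1

/-- A discrete group with a finitely generated finite index subgroup acting on `Y × ℝ` by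
isometries of `Y` and translations of `ℝ`, and containing a pure translation of `ℝ`, virtually
splits. -/
theorem virtuallySplitsAlong_of_product_action (φ : X ≃ᵢ WithLp 2 (Y × ℝ)) [Nonempty Y]
    {Γ K : Subgroup (X ≃ᵢ X)} (hd : IsDiscreteGroup Γ) (hKΓ : K ≤ Γ) (hidx : K.relIndex Γ ≠ 0)
    [Group.FG K] (α : K →* (Y ≃ᵢ Y)) (τ : K →* Multiplicative ℝ)
    (hact : ∀ (γ : K) (x : X),
      φ ((γ : X ≃ᵢ X) x) = WithLp.toLp 2 (α γ (φ x).fst, (φ x).snd + (τ γ).toAdd))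
    {z : K} {L : ℝ} (hL : 0 < L) (hαz : α z = 1) (hτz : (τ z).toAdd = L) :
    VirtuallySplitsAlong Γ φ := by
  have hdist : ∀ (γ : K) (x : X), dist x ((γ : X ≃ᵢ X) x) =
      Real.sqrt (dist (φ x).fst (α γ (φ x).fst) ^ 2 + (τ γ).toAdd ^ 2) := fun γ x => by
    rw [← φ.dist_eq, WithLp.prod_dist_eq_sqrt, hact]
    change Real.sqrt (dist (φ x).fst (α γ (φ x).fst) ^ 2 +
      dist (φ x).snd ((φ x).snd + (τ γ).toAdd) ^ 2) = _
    rw [Real.dist_eq, sub_add_cancel_left, abs_neg, sq_abs]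
  have hτzn : ∀ n : ℤ, (τ (z ^ n)).toAdd = n * L := fun n => by
    rw [map_zpow, toAdd_zpow, hτz, zsmul_eq_mul]
  have hαzn : ∀ n : ℤ, α (z ^ n) = 1 := fun n => by rw [map_zpow, hαz, one_zpow]
  -- multiplying by a power of `z` makes the translation part small
  have hred : ∀ γ : K, 0 ≤ (τ (γ * z ^ (-⌊(τ γ).toAdd / L⌋))).toAdd ∧
      (τ (γ * z ^ (-⌊(τ γ).toAdd / L⌋))).toAdd < L := fun γ => by
    rw [map_mul, toAdd_mul, hτzn]
    have h1 := Int.floor_le ((τ γ).toAdd / L)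
    have h2 := Int.lt_floor_add_one ((τ γ).toAdd / L)
    rw [le_div_iff₀ hL] at h1
    rw [div_lt_iff₀ hL] at h2
    push_cast
    constructor <;> linarith
  obtain ⟨y₀⟩ := ‹Nonempty Y›
  obtain ⟨H, hH, hzH, χ, hχ⟩ := exists_finite_index_character τ (z := z)
    (fun e => hL.ne' (by rw [← hτz, e]; rfl))
  set zH : H := ⟨z, hzH⟩
  have hχn : ∀ n : ℤ, χ (zH ^ n) = Multiplicative.ofAdd n := fun n => by
    rw [map_zpow, hχ, ← ofAdd_zsmul, smul_eq_mul, mul_one]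
  -- Such a `γ` is a pure translation. Powers of `z` bring the translation parts of all `γ ^ n` into
  -- `[0, L)`, so by discreteness two of the products coincide. Applying `χ` shows that the same
  -- power of `z` was used, hence `γ` translates by `0`.
  have hker : ∀ γ : H, α γ = 1 → χ γ = 1 → γ = 1 := by
    intro γ hαγ hχγ
    set x₀ := φ.symm (WithLp.toLp 2 (y₀, 0))
    have hfin := hd x₀ L hL.le
    let m : ℤ → ℤ := fun n => -⌊(τ ((γ : K) ^ n)).toAdd / L⌋
    let f : ℤ → {g : X ≃ᵢ X | g ∈ Γ ∧ dist x₀ (g x₀) < L} := fun n =>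
      ⟨(((γ : K) ^ n * z ^ m n : K) : X ≃ᵢ X), hKΓ (Subtype.property _), by
        obtain ⟨h1, h2⟩ := hred ((γ : K) ^ n)
        rw [hdist, map_mul α, hαzn, map_zpow α, hαγ, one_zpow, one_mul,
          show (1 : Y ≃ᵢ Y) (φ x₀).fst = (φ x₀).fst from rfl, dist_self, zero_pow two_ne_zero,
          zero_add, Real.sqrt_sq h1]
        exact h2⟩
    have : Finite {g : X ≃ᵢ X | g ∈ Γ ∧ dist x₀ (g x₀) < L} := hfin
    obtain ⟨n, n', hne, hnn⟩ := Finite.exists_ne_map_eq_of_infinite f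
    have h1 : (γ : K) ^ n * z ^ m n = (γ : K) ^ n' * z ^ m n' :=
      Subtype.ext (congrArg (fun g => (g.1 : X ≃ᵢ X)) hnn)
    have h2 : γ ^ n * zH ^ m n = γ ^ n' * zH ^ m n' := Subtype.ext (by simpa using h1)
    have h3 := congrArg χ h2
    rw [map_mul, map_mul, map_zpow χ γ, map_zpow χ γ, hχγ, one_zpow, one_zpow, one_mul, one_mul,
      hχn, hχn] at h3
    have h4 : m n = m n' := Multiplicative.ofAdd.injective h3
    rw [h4] at h1
    have h5 := congrArg (fun k : K => (τ k).toAdd) (mul_right_cancel h1)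
    simp only [map_zpow, toAdd_zpow, zsmul_eq_mul] at h5
    have h6 : (τ γ).toAdd = 0 := by
      by_contra h0
      exact hne (by exact_mod_cast mul_right_cancel₀ h0 h5)
    refine Subtype.ext (Subtype.ext (IsometryEquiv.ext fun x => φ.injective ?_))
    rw [hact, hαγ, h6, add_zero]
    rfl
  have htrans : ∀ γ : H, α γ = 1 → (τ γ).toAdd = (χ γ).toAdd * L := by
    intro γ hαγ
    have h1 := hker (γ * zH ^ (-(χ γ).toAdd))
      (by
        rw [Subgroup.coe_mul, map_mul, hαγ, one_mul, SubgroupClass.coe_zpow]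
        exact hαzn _)
      (by rw [map_mul, hχn, ofAdd_neg, ofAdd_toAdd, mul_inv_cancel])
    rw [zpow_neg, mul_inv_eq_one] at h1
    nth_rw 1 [h1]
    rw [SubgroupClass.coe_zpow]
    exact hτzn _
  let ι := integralTranslations L
  let αH : H →* (Y ≃ᵢ Y) := α.comp H.subtype
  -- The second component records `χ`, not the actual translation `τ`; the two agree when `α γ = 1`,
  -- by `htrans`. Surjectivity holds because powers of `z` change `χ` freely without changing `α`.
  let e₀ : H →* αH.range × ι.range := αH.rangeRestrict.prod (ι.rangeRestrict.comp χ)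
  have he₀ : Function.Bijective e₀ := by
    constructor
    · refine (injective_iff_map_eq_one e₀).2 fun γ hγ => hker γ ?_ ?_
      · exact congrArg (fun p : αH.range × ι.range => (p.1 : Y ≃ᵢ Y)) hγ
      · refine integralTranslations_injective hL ?_
        rw [map_one]
        exact congrArg (fun p : αH.range × ι.range => (p.2 : ℝ ≃ᵢ ℝ)) hγ
    · rintro ⟨⟨_, γ, rfl⟩, ⟨_, n, rfl⟩⟩
      refine ⟨γ * zH ^ (n.toAdd - (χ γ).toAdd), Prod.ext (Subtype.ext ?_) (Subtype.ext ?_)⟩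
      · change α ((γ * zH ^ (n.toAdd - (χ γ).toAdd) : H) : K) = α γ
        rw [Subgroup.coe_mul, map_mul, SubgroupClass.coe_zpow]
        exact (congrArg _ (hαzn _)).trans (mul_one _)
      · change ι (χ (γ * zH ^ (n.toAdd - (χ γ).toAdd))) = ι n
        rw [map_mul χ, hχn, ofAdd_sub, ofAdd_toAdd, ofAdd_toAdd, mul_div_cancel]
  let E := H.equivMapOfInjective K.subtype K.subtype_injective
  have hE : ∀ γ : H.map K.subtype, ((E.symm γ : K) : X ≃ᵢ X) = γ := fun γ => by
    conv_rhs => rw [← E.apply_symm_apply γ]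
    rfl
  refine ⟨H.map K.subtype, αH.range, ι.range, E.symm.trans (MulEquiv.ofBijective e₀ he₀),
    (Subgroup.map_subtype_le H).trans hKΓ, ?_, ?_, isDiscreteGroup_integralTranslations hL,
    ⟨(MonoidHom.ofInjective (integralTranslations_injective hL)).symm⟩, fun γ => ?_⟩
  · rw [← Subgroup.relIndex_mul_relIndex _ _ _ (Subgroup.map_subtype_le H) hKΓ]
    refine mul_ne_zero ?_ hidx
    rwa [Subgroup.relIndex, Subgroup.subgroupOf,
      Subgroup.comap_map_eq_self_of_injective K.subtype_injective]
  · intro y η _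
    set x := φ.symm (WithLp.toLp 2 (y, 0)) with hx
    have hφx : (φ x).fst = y := by rw [hx, φ.apply_symm_apply]; rfl
    classical
    refine ((hd x (η + L) (by positivity)).image
      fun g => if hg : g ∈ K then α ⟨g, hg⟩ else 1).subset ?_
    rintro _ ⟨⟨γ, rfl⟩, hγ⟩
    obtain ⟨h1, h2⟩ := hred γ
    set γ' : K := γ * z ^ (-⌊(τ γ).toAdd / L⌋) with hγ'
    have hαγ' : α γ' = α γ := by rw [hγ', map_mul, hαzn, mul_one]
    refine ⟨γ', ⟨hKΓ γ'.2, ?_⟩, ?_⟩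
    · rw [hdist, hαγ', hφx]
      have h3 : dist y (α γ y) < η := hγ
      refine (Real.sqrt_lt_sqrt (by positivity) ?_).trans_eq (Real.sqrt_sq (by positivity))
      nlinarith [dist_nonneg (x := y) (y := α γ y)]
    · simp only [SetLike.coe_mem, dite_true, Subtype.coe_eta]
      exact hαγ'
  · refine ⟨IsometryEquiv.addRight (τ (E.symm γ : H)).toAdd, fun x => ?_, fun hγ => ?_⟩
    · conv_lhs => rw [← hE γ]
      exact hact _ x
    · refine IsometryEquiv.ext fun t => ?_
      have h1 : α (E.symm γ : H) = 1 := congrArg Subtype.val hγ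
      change t + (τ (E.symm γ : H)).toAdd = t + (χ (E.symm γ)).toAdd * L
      rw [htrans _ h1]

end ProductActions

/-! ### Normalizing the axis direction and assembling the splitting -/

/-- In a relation between powers of `k * g * k⁻¹` and `g`, the exponents have equal absolute value,
because conjugation preserves the nonzero translation distance. -/
theorem conj_pow_eq_or_eq_inv {X : Type u} [MetricSpace X] {g k : X ≃ᵢ X} {c : ℝ → X} {l : ℝ}
    (hc : Isometry c) (hgc : TranslatesLine g c l) (hl : 0 < l)
    (hcp : HaveCommonPower (k * g * k⁻¹) g) :
    ∃ a : ℕ, 0 < a ∧ (k * g ^ a * k⁻¹ = g ^ a ∨ k * g ^ a * k⁻¹ = (g ^ a)⁻¹) := by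
  obtain ⟨a, b, ha, -, e⟩ := hcp
  have h1 := (hgc.conj k).zpow a
  rw [e] at h1
  have h2 := h1.abs_eq (hgc.zpow b) (k.isometry.comp hc) hc
  rw [abs_mul, abs_mul, mul_left_inj' (abs_pos.2 hl.ne').ne'] at h2
  have h3 : |a| = |b| := by exact_mod_cast h2
  rw [conj_zpow] at e
  refine ⟨a.natAbs, Int.natAbs_pos.2 ha, ?_⟩
  rcases abs_eq_abs.1 h3 with h4 | h4 <;> rcases Int.natAbs_eq a with h5 | h5
  · rw [← h4, h5, zpow_natCast] at e
    exact Or.inl e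
  · rw [← h4, h5, zpow_neg, zpow_natCast, ← conj_inv, inv_inj] at e
    exact Or.inl e
  · rw [← neg_eq_iff_eq_neg.2 h4, h5, zpow_neg, zpow_natCast] at e
    exact Or.inr e
  · rw [← neg_eq_iff_eq_neg.2 h4, h5, neg_neg, zpow_neg, zpow_natCast, ← conj_inv] at e
    exact Or.inr (inv_eq_iff_eq_inv.1 e)

/-- An isometry which permutes the vertical lines of `Y × ℝ` preserving their orientation
acts as the product of a map of `Y` and a translation of `ℝ`. -/
theorem exists_product_form {X Y : Type u} [MetricSpace X] [MetricSpace Y]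
    (𝓛 : ParallelFamily X) (φ : X ≃ᵢ WithLp 2 (Y × ℝ)) [Nonempty Y]
    (hφ : ∀ c ∈ 𝓛.lines, ∀ t, φ (c t) = WithLp.toLp 2 ((φ (c 0)).fst, (φ (c 0)).snd + t))
    {k : X ≃ᵢ X} (hk : ∀ c ∈ 𝓛.lines, (fun t => k (c t)) ∈ 𝓛.lines) :
    ∃ (A : Y → Y) (b : ℝ), ∀ x, φ (k x) = WithLp.toLp 2 (A (φ x).fst, (φ x).snd + b) := by
  let s : Y → X := fun y => φ.symm (WithLp.toLp 2 (y, 0))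
  have hs : ∀ y, φ (s y) = WithLp.toLp 2 (y, 0) := fun y => φ.apply_symm_apply _
  have h1 : ∀ x, φ (k x) = WithLp.toLp 2 ((φ (k (s (φ x).fst))).fst,
      (φ x).snd + (φ (k (s (φ x).fst))).snd) := by
    intro x
    obtain ⟨c, hc, hc0⟩ := 𝓛.exists_line (s (φ x).fst)
    have hx : x = c (φ x).snd := by
      apply φ.injective
      rw [hφ c hc, hc0, hs]
      change φ x = WithLp.toLp 2 ((φ x).fst, 0 + (φ x).snd)
      rw [zero_add]
      rfl
    have h2 := hφ _ (hk c hc) (φ x).snd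
    rw [← hx, hc0] at h2
    rw [h2, add_comm]
  obtain ⟨y₀⟩ := ‹Nonempty Y›
  -- Heights `1` and `-1` over `y` are equidistant from the base point over `y₀`; a relative shift
  -- `r` of the image fibres would break this symmetry.
  have hconst : ∀ y, (φ (k (s y))).snd = (φ (k (s y₀))).snd := by
    intro y
    set r := (φ (k (s y))).snd - (φ (k (s y₀))).snd with hr
    have hd : ∀ t : ℝ, dist y y₀ ^ 2 + t ^ 2 =
        dist (φ (k (s y))).fst (φ (k (s y₀))).fst ^ 2 + (t + r) ^ 2 := by
      intro t
      set x := φ.symm (WithLp.toLp 2 (y, t))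
      have hφx : φ x = WithLp.toLp 2 (y, t) := φ.apply_symm_apply _
      have h2 : dist (φ x) (φ (s y₀)) = dist (φ (k x)) (φ (k (s y₀))) := by
        rw [φ.dist_eq, φ.dist_eq, k.dist_eq]
      rw [h1 x, hφx, hs, WithLp.prod_dist_eq_sqrt, WithLp.prod_dist_eq_sqrt,
        Real.sqrt_inj (by positivity) (by positivity)] at h2
      simp only [Real.dist_eq, sq_abs, sub_zero, WithLp.toLp_fst, WithLp.toLp_snd] at h2
      rw [h2, hr]
      ring
    have h3 := hd 1
    have h4 := hd (-1)
    linarith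
  exact ⟨fun y => (φ (k (s y))).fst, (φ (k (s y₀))).snd, fun x => by rw [h1 x, hconst]⟩

theorem lemma4p3 {X : Type u} [MetricSpace X] [CompleteSpace X] [Nonempty X]
    (hcat : IsCAT0 X) (hgc : IsGeodesicallyComplete X)
    (P₀ r₀ : ℝ) (hP₀ : 0 < P₀) (hr₀ : 0 < r₀) (hpack : IsPackedAtScale X P₀ r₀)
    (Γ : Subgroup (X ≃ᵢ X)) (hdisc : IsDiscreteGroup Γ) (hslim : IsSlimGroup Γ)
    (hac : IsAlmostCocompact Γ) (lam₀ : ℝ)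
    (hcover : (⋃ g ∈ shortHyperbolics Γ lam₀, minSet g) = univ)
    (hvc : ∀ g ∈ shortHyperbolics Γ lam₀, ∀ h ∈ shortHyperbolics Γ lam₀,
      (minSet g ∩ minSet h).Nonempty → IsVirtuallyCyclic (Subgroup.closure {g, h})) :
    ∃ (Y : Type u) (_ : MetricSpace Y) (φ : X ≃ᵢ WithLp 2 (Y × ℝ)),
      (Γ.FG → VirtuallySplitsAlong Γ φ) := by
  have := hcat.preconnectedSpace
  have hcp := haveCommonPower_of_cover hdisc lam₀ (fun g hg => ⟨hg.1, hg.2.2.1, hg.2.1.1⟩) hcover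
    fun g hg h hh hgh => (hvc g hg h hh hgh).haveCommonPower (hcat.pow_ne_one hg.2.1)
      (hcat.pow_ne_one hh.2.1)
  have hcov : ∀ x, ∃ g ∈ shortHyperbolics Γ lam₀, x ∈ minSet g := fun x => by
    have : x ∈ ⋃ g ∈ shortHyperbolics Γ lam₀, minSet g := hcover ▸ mem_univ x
    simpa only [mem_iUnion, exists_prop] using this
  obtain ⟨g₀, hg₀, hx₀⟩ := hcov (Classical.arbitrary X)
  obtain ⟨c₀, hc₀, -, hgc₀⟩ := hcat.exists_axis hg₀.2.1 hx₀
  replace hgc₀ : TranslatesLine g₀ c₀ (translationLength g₀) := hgc₀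
  have hl : 0 < translationLength g₀ := hg₀.2.1.2
  set l := translationLength g₀ with hl_def
  let 𝓛 : ParallelFamily X :=
    { lines := virtualAxes g₀ l
      isometry := fun c hc => hc.1
      parallel := fun c hc c' hc' => hcat.areParallel_of_mem_virtualAxes hl hc hc'
      exists_line := fun x => by
        obtain ⟨g, hg, hx⟩ := hcov x
        exact hcat.exists_virtualAxis hg.2.1 hc₀ hgc₀ hl (hcp g hg g₀ hg₀) hx }
  have hc₀L : c₀ ∈ 𝓛.lines := ⟨hc₀, 1, one_pos, by simpa using hgc₀⟩
  obtain ⟨Y, _, φ, hφ⟩ := 𝓛.exists_splitting hcat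
  refine ⟨Y, _, φ, fun hfg => ?_⟩
  have : Nonempty Y := ⟨(φ (Classical.arbitrary X)).fst⟩
  obtain ⟨N, hN, hconj⟩ := hfg.exists_pow_conj fun γ hγ =>
    conj_pow_eq_or_eq_inv hc₀ hgc₀ hl (hcp _ (conj_mem_shortHyperbolics hg₀ hγ) _ hg₀)
  set z := g₀ ^ N with hz
  have hzc₀ : TranslatesLine z c₀ (N * l) := hgc₀.pow N
  have hL : 0 < N * l := by positivity
  -- The sublevel set is convex because displacement is, and invariant because `Γ` conjugates `z` to
  -- `z` or `z⁻¹`, which have equal displacement.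
  have hzle : ∀ x, dist x (z x) ≤ N * l := by
    have hF : {x | dist x (z x) ≤ N * l} = univ := by
      refine eq_univ_of_invariant_convex hcat hgc hdisc hslim hac
        (isClosed_le (continuous_id.dist z.continuous) continuous_const) ⟨c₀ 0, ?_⟩ ?_ ?_
      · rw [mem_ofPred_eq, hzc₀, hc₀.dist_eq, Real.dist_eq, zero_add, zero_sub, abs_neg,
          abs_of_pos hL]
      · intro x hx y hy m hm
        have := hcat.dist_midpoints_le hm (hm.map z)
        rw [mem_ofPred_eq] at hx hy ⊢
        linarith
      · intro γ hγ x hx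
        rw [mem_ofPred_eq] at hx ⊢
        rcases hconj γ⁻¹ (Γ.inv_mem hγ) with e | e
        · have e' : z * γ = γ * z := by nth_rw 2 [← e]; group
          rwa [← IsometryEquiv.mul_apply, e', IsometryEquiv.mul_apply, γ.dist_eq]
        · have e' : z * γ = γ * z⁻¹ := by rw [← e]; group
          rw [← IsometryEquiv.mul_apply, e', IsometryEquiv.mul_apply, γ.dist_eq,
            ← z.dist_eq, show z (z⁻¹ x) = x from z.apply_symm_apply x, dist_comm]
          exact hx
    exact fun x => hF.symm.subset (mem_univ x)
  set K := Γ ⊓ Subgroup.centralizer {z} with hK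
  have hidx : K.relIndex Γ ≠ 0 :=
    relIndex_centralizer_ne_zero (T := {z, z⁻¹}) (by simp) hconj
  have : Group.FG K := by
    have : Group.FG Γ := (Group.fg_iff_subgroup_fg Γ).2 hfg
    have : (K.subgroupOf Γ).FiniteIndex := ⟨hidx⟩
    have : Group.FG (K.subgroupOf Γ) := inferInstance
    exact Group.fg_of_surjective (f := (Subgroup.subgroupOfEquivOfLe (inf_le_left : K ≤ Γ)).toMonoidHom)
      (Subgroup.subgroupOfEquivOfLe (inf_le_left : K ≤ Γ)).surjective
  obtain ⟨α, τ, hact⟩ := exists_product_action φ K fun γ hγ =>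
    exists_product_form 𝓛 φ hφ fun c hc => by
      obtain ⟨hci, n, hn, hcn⟩ := hc
      -- `γ` is known to commute with `z = g₀ ^ N` only, so the exponent is enlarged to a multiple
      -- of `N`.
      refine ⟨γ.isometry.comp hci, N * n, by positivity, fun t => ?_⟩
      have h1 := hcn.pow N t
      have h2 : Commute (z ^ n) γ :=
        Commute.pow_left (Subgroup.mem_centralizer_singleton_iff.1 hγ.2).symm n
      rw [pow_mul, ← hz, ← IsometryEquiv.mul_apply, h2.eq, IsometryEquiv.mul_apply, hz, ← pow_mul,
        mul_comm N n, pow_mul, h1]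
      push_cast
      rw [show (N : ℝ) * (n * l) = n * N * l by ring]
  have hzK : z ∈ K := ⟨Γ.pow_mem hg₀.1 N, Subgroup.mem_centralizer_singleton_iff.2 rfl⟩
  have hτz : (τ ⟨z, hzK⟩).toAdd = N * l := by
    have h1 := hact ⟨z, hzK⟩ (c₀ 0)
    rw [show (z : X ≃ᵢ X) (c₀ 0) = c₀ (0 + N * l) from hzc₀ 0, zero_add, hφ c₀ hc₀L] at h1
    have h2 := congrArg WithLp.snd h1
    exact (add_left_cancel h2).symm
  refine virtuallySplitsAlong_of_product_action φ hdisc inf_le_left hidx α τ hact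
    (z := ⟨z, hzK⟩) hL (IsometryEquiv.ext fun y => ?_) hτz
  -- The translation part of `z` already uses up the whole displacement `N * l`, leaving none for
  -- the `Y` component.
  have h1 := hzle (φ.symm (WithLp.toLp 2 (y, 0)))
  rw [← φ.dist_eq, WithLp.prod_dist_eq_sqrt, Real.sqrt_le_left hL.le,
    hact ⟨z, hzK⟩, φ.apply_symm_apply, hτz] at h1
  simp only [Real.dist_eq, zero_add, zero_sub, neg_sq, sq_abs, WithLp.toLp_fst,
    WithLp.toLp_snd] at h1
  have h2 : dist y (α ⟨z, hzK⟩ y) ^ 2 ≤ 0 := by linarith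
  exact (dist_eq_zero.1 (pow_eq_zero_iff two_ne_zero |>.1 (le_antisymm h2 (sq_nonneg _)))).symm
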